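/- Let $M$ be a smooth $n$-dimensional manifold with a Riemannian metric $\gamma_{ij}(x)$, let $\sigma$ be a smooth real function on an open subset of $TM$ (for example the complement of a field of hyperplanes), and consider the generalized Lagrange metric $g_{ij}(x,y)=e^{2\sigma(x,y)}\gamma_{ij}(x)$. All formulas below are in the coordinates $(x^i,y^i)$ of $TM$ induced by an arbitrary chart of $M$, at an arbitrary point of the domain of $\sigma$; repeated indices are summed. **Notation.** Let $\Gamma^i_{jk}$ be the Christoffel symbols of $\gamma$, $N^i_j=\Gamma^i_{jk}y^k$, $\frac{\delta}{\delta x^i}=\frac{\partial}{\partial x^i}-N^j_i\frac{\partial}{\partial y^j}$, and $R^i_{jk}=\frac{\delta N^i_j}{\delta x^k}-\frac{\delta N^i_k}{\delta x^j}$. Let $$r^i_{hjk}=\partial_k\Gamma^i_{hj}-\partial_j\Gamma^i_{hk}+\Gamma^s_{hj}\Gamma^i_{sk}-\Gamma^s_{hk}\Gamma^i_{sj},\qquad r_{ij}=r^k_{ijk},\qquad r=\gamma^{ij}r_{ij}.$$ Let $_{|k}$ and $|_k$ be the $h$- and $v$-covariant derivatives of the canonical metrical connection of $g$ with respect to $N$,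 whose coefficients are $$L^i_{jk}=\tfrac12 g^{ih}\Big(\tfrac{\delta g_{hk}}{\delta x^j}+\tfrac{\delta g_{jh}}{\delta x^k}-\tfrac{\delta g_{jk}}{\delta x^h}\Big),\qquad C^i_{jk}=\tfrac12 g^{ih}\Big(\tfrac{\partial g_{hk}}{\partial y^j}+\tfrac{\partial g_{jh}}{\partial y^k}-\tfrac{\partial g_{jk}}{\partial y^h}\Big),$$ so that for instance $w_{i|j}=\frac{\delta w_i}{\delta x^j}-L^m_{ij}w_m$ and $w_i|_j=\frac{\partial w_i}{\partial y^j}-C^m_{ij}w_m$. Put $\sigma_i=\frac{\delta\sigma}{\delta x^i}$, $\dot\sigma_a=\frac{\partial\sigma}{\partial y^a}$ and $$\sigma^H=\gamma^{kl}\sigma_k\sigma_l,\quad \sigma_{ij}=\sigma_{i|j}+\sigma_i\sigma_j-\tfrac12\gamma_{ij}\sigma^H,\quad \bar\sigma=\gamma^{ij}\sigma_{ij},$$ $$\sigma^V=\gamma^{ab}\dot\sigma_a\dot\sigma_b,\quad \dot\sigma_{ab}=\dot\sigma_a|_b+\dot\sigma_a\dot\sigma_b-\tfrac12\gamma_{ab}\sigma^V,\quad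 \dot\sigma=\gamma^{ab}\dot\sigma_{ab}.$$ **Maxwell equations.** The electromagnetic tensors $F_{ij}=\frac12(D_{ij}-D_{ji})$ and $f_{ij}=\frac12(d_{ij}-d_{ji})$, where $D_{ij}=g_{im}\,y^m{}_{|j}$ and $d_{ij}=g_{im}\,y^m|_j$ are the deflection tensors, are $$F_{ij}=(g_{ip}\sigma_j-g_{jp}\sigma_i)y^p,\qquad f_{ij}=(g_{ip}\dot\sigma_j-g_{jp}\dot\sigma_i)y^p,$$ and, with $\sum_{(ijk)}$ the sum over the cyclic permutations of $i,j,k$, $$F_{ij|k}+F_{jk|i}+F_{ki|j}=-\sum_{(ijk)}g_{ip}\,r^h_{qjk}\,\dot\sigma_h\,y^py^q,$$ $$F_{ij}|_k+F_{jk}|_i+F_{ki}|_j=-(f_{ij|k}+f_{jk|i}+f_{ki|j}),\qquad f_{ij}|_k+f_{jk}|_i+f_{ki}|_j=0.$$ **Einstein equations.** Let $$R^i_{hjk}=\tfrac{\delta L^i_{hj}}{\delta x^k}-\tfrac{\delta L^i_{hk}}{\delta x^j}+L^s_{hj}L^i_{sk}-L^s_{hk}L^i_{sj}+C^i_{hs}R^s_{jk},\qquad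 S^i_{hjk}=\tfrac{\partial C^i_{hj}}{\partial y^k}-\tfrac{\partial C^i_{hk}}{\partial y^j}+C^s_{hj}C^i_{sk}-C^s_{hk}C^i_{sj}$$ be the $h$- and $v$-curvature, $R_{ij}=R^k_{ijk}$, $S_{ab}=S^c_{abc}$, $R=g^{ij}R_{ij}$, $S=g^{ab}S_{ab}$. For every constant $\mathcal K$ and all components $T^H_{ij}$, $T^V_{ab}$, the Einstein equations $$R_{ij}-\tfrac12R\,g_{ij}=\mathcal K\,T^H_{ij},\qquad S_{ab}-\tfrac12S\,g_{ab}=\mathcal K\,T^V_{ab}$$ are equivalent to $$r_{ij}-\tfrac12 r\gamma_{ij}+t_{ij}=\mathcal K\,T^H_{ij},\qquad (2-n)(\dot\sigma_{ab}-\dot\sigma\gamma_{ab})=\mathcal K\,T^V_{ab},$$ where $$t_{ij}=(n-2)(\gamma_{ij}\bar\sigma-\sigma_{ij})-\gamma_{ij}r_{st}y^s\gamma^{tp}\dot\sigma_p+\dot\sigma_i r^a_{tja}y^t-\gamma_{is}\gamma^{ap}\dot\sigma_p r^s_{tja}y^t.$$ -/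

import Mathlib

open scoped Manifold ContDiff

namespace GenLagrange

noncomputable section

/-- The coordinate space `ℝⁿ`. -/
abbrev Coord (n : ℕ) := EuclideanSpace ℝ (Fin n)

/-- A real function of the coordinates `(x, y)` of the tangent bundle. -/
abbrev Fn (n : ℕ) := Coord n → Coord n → ℝ

/-! ### Components in the coordinates of the tangent bundle induced by a chart -/

section Charts

/-- The components `γ_ij(x)` of a Riemannian metric in the chart `e`. -/
def localMetric {n : ℕ} {M : Type*} [TopologicalSpace M] [ChartedSpace (Coord n) M]
    [IsManifold (𝓡 n) ∞ M]
    (γ : Bundle.ContMDiffRiemannianMetric (𝓡 n) ∞ (Coord n) (fun p : M => TangentSpace (𝓡 n) p))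
    (e : OpenPartialHomeomorph M (Coord n)) : Coord n → Matrix (Fin n) (Fin n) ℝ :=
  fun x => Matrix.of fun i j =>
    γ.inner (e.symm x)
      (mfderiv (𝓡 n) (𝓡 n) e.symm x (EuclideanSpace.single i (1 : ℝ) : Coord n))
      (mfderiv (𝓡 n) (𝓡 n) e.symm x (EuclideanSpace.single j (1 : ℝ) : Coord n))

/-- The point of `TM` with induced coordinates `(x, y)`: the vector `y^i ∂/∂x^i` at the point
with coordinates `x`. -/
def tangentPoint {n : ℕ} {M : Type*} [TopologicalSpace M] [ChartedSpace (Coord n) M]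
    (e : OpenPartialHomeomorph M (Coord n)) (x y : Coord n) : TangentBundle (𝓡 n) M :=
  ⟨e.symm x, mfderiv (𝓡 n) (𝓡 n) e.symm x y⟩

/-- The coordinate expression `σ(x, y)` of a function on (a part of) `TM`. -/
def localFn {n : ℕ} {M : Type*} [TopologicalSpace M] [ChartedSpace (Coord n) M]
    (σ : TangentBundle (𝓡 n) M → ℝ) (e : OpenPartialHomeomorph M (Coord n)) : Fn n :=
  fun x y => σ (tangentPoint e x y)

end Charts

/-! ### Derivatives and the nonlinear connection -/

/-- `∂f/∂x^i` for a function of `x` alone. -/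
def pd {n : ℕ} (i : Fin n) (f : Coord n → ℝ) : Coord n → ℝ :=
  fun x => fderiv ℝ f x (EuclideanSpace.single i 1)

/-- `∂f/∂x^i` for a function of `(x, y)`. -/
def dx {n : ℕ} (i : Fin n) (f : Fn n) : Fn n := fun x y => pd i (fun x' => f x' y) x

/-- `∂f/∂y^i`. -/
def dy {n : ℕ} (i : Fin n) (f : Fn n) : Fn n := fun x y => pd i (f x) y

/-- The Christoffel symbols `Γ^i_jk(x)` of `γ_ij`. -/
def christoffel {n : ℕ} (γ : Coord n → Matrix (Fin n) (Fin n) ℝ) (i j k : Fin n) :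
    Coord n → ℝ := fun x =>
  (1 / 2) * ∑ h, (γ x)⁻¹ i h *
    (pd j (fun z => γ z h k) x + pd k (fun z => γ z j h) x - pd h (fun z => γ z j k) x)

/-- The nonlinear connection `N^i_j(x, y) = Γ^i_jk(x) y^k`. -/
def N {n : ℕ} (γ : Coord n → Matrix (Fin n) (Fin n) ℝ) (i j : Fin n) : Fn n := fun x y =>
  ∑ k, christoffel γ i j k x * y k

/-- `δf/δx^i = ∂f/∂x^i - N^j_i ∂f/∂y^j`. -/
def delta {n : ℕ} (γ : Coord n → Matrix (Fin n) (Fin n) ℝ) (i : Fin n) (f : Fn n) : Fn n :=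
  fun x y => dx i f x y - ∑ j, N γ j i x y * dy j f x y

/-- The curvature of the nonlinear connection, `R^i_jk = δN^i_j/δx^k - δN^i_k/δx^j`. -/
def curvN {n : ℕ} (γ : Coord n → Matrix (Fin n) (Fin n) ℝ) (i j k : Fin n) : Fn n :=
  fun x y => delta γ k (N γ i j) x y - delta γ j (N γ i k) x y

/-! ### Curvature of the metric `γ_ij(x)` -/

/-- The curvature tensor `r^i_hjk = ∂_k Γ^i_hj - ∂_j Γ^i_hk + Γ^s_hj Γ^i_sk - Γ^s_hk Γ^i_sj`;
`rCurv γ i h j k` is `r^i_hjk`. -/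
def rCurv {n : ℕ} (γ : Coord n → Matrix (Fin n) (Fin n) ℝ) (i h j k : Fin n) :
    Coord n → ℝ := fun x =>
  pd k (christoffel γ i h j) x - pd j (christoffel γ i h k) x +
    ∑ s, (christoffel γ s h j x * christoffel γ i s k x -
      christoffel γ s h k x * christoffel γ i s j x)

/-- `r_ij = r^k_ijk`. -/
def rRic {n : ℕ} (γ : Coord n → Matrix (Fin n) (Fin n) ℝ) (i j : Fin n) : Coord n → ℝ :=
  fun x => ∑ k, rCurv γ k i j k x

/-- `r = γ^ij r_ij`. -/
def rScal {n : ℕ} (γ : Coord n → Matrix (Fin n) (Fin n) ℝ) : Coord n → ℝ :=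
  fun x => ∑ i, ∑ j, (γ x)⁻¹ i j * rRic γ i j x

/-! ### The metric `g_ij = e^{2σ} γ_ij` and its canonical metrical connection -/

/-- The generalized Lagrange metric `g_ij(x, y) = e^{2σ(x,y)} γ_ij(x)`. -/
def g {n : ℕ} (γ : Coord n → Matrix (Fin n) (Fin n) ℝ) (σ : Fn n) (x y : Coord n) :
    Matrix (Fin n) (Fin n) ℝ := Real.exp (2 * σ x y) • γ x

/-- Horizontal coefficients
`L^i_jk = ½ g^ih (δg_hk/δx^j + δg_jh/δx^k - δg_jk/δx^h)`. -/
def L {n : ℕ} (γ : Coord n → Matrix (Fin n) (Fin n) ℝ) (σ : Fn n) (i j k : Fin n) : Fn n :=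
  fun x y => (1 / 2) * ∑ h, (g γ σ x y)⁻¹ i h *
    (delta γ j (fun x' y' => g γ σ x' y' h k) x y + delta γ k (fun x' y' => g γ σ x' y' j h) x y
      - delta γ h (fun x' y' => g γ σ x' y' j k) x y)

/-- Vertical coefficients
`C^i_jk = ½ g^ih (∂g_hk/∂y^j + ∂g_jh/∂y^k - ∂g_jk/∂y^h)`. -/
def C {n : ℕ} (γ : Coord n → Matrix (Fin n) (Fin n) ℝ) (σ : Fn n) (i j k : Fin n) : Fn n :=
  fun x y => (1 / 2) * ∑ h, (g γ σ x y)⁻¹ i h *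
    (dy j (fun x' y' => g γ σ x' y' h k) x y + dy k (fun x' y' => g γ σ x' y' j h) x y
      - dy h (fun x' y' => g γ σ x' y' j k) x y)

/-- `X^i_{|j}` for a vector field. -/
def hCovVec {n : ℕ} (γ : Coord n → Matrix (Fin n) (Fin n) ℝ) (σ : Fn n)
    (X : Fin n → Fn n) (i j : Fin n) : Fn n :=
  fun x y => delta γ j (X i) x y + ∑ m, L γ σ i m j x y * X m x y

/-- `X^i|_j` for a vector field. -/
def vCovVec {n : ℕ} (γ : Coord n → Matrix (Fin n) (Fin n) ℝ) (σ : Fn n)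
    (X : Fin n → Fn n) (i j : Fin n) : Fn n :=
  fun x y => dy j (X i) x y + ∑ m, C γ σ i m j x y * X m x y

/-- `w_{i|j}` for a covector field. -/
def hCov1 {n : ℕ} (γ : Coord n → Matrix (Fin n) (Fin n) ℝ) (σ : Fn n)
    (w : Fin n → Fn n) (i j : Fin n) : Fn n :=
  fun x y => delta γ j (w i) x y - ∑ m, L γ σ m i j x y * w m x y

/-- `w_i|_j` for a covector field. -/
def vCov1 {n : ℕ} (γ : Coord n → Matrix (Fin n) (Fin n) ℝ) (σ : Fn n)
    (w : Fin n → Fn n) (i j : Fin n) : Fn n :=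
  fun x y => dy j (w i) x y - ∑ m, C γ σ m i j x y * w m x y

/-- `T_{ij|k}` for a tensor field of type `(0, 2)`. -/
def hCov2 {n : ℕ} (γ : Coord n → Matrix (Fin n) (Fin n) ℝ) (σ : Fn n)
    (T : Fin n → Fin n → Fn n) (i j k : Fin n) : Fn n :=
  fun x y => delta γ k (T i j) x y - ∑ m, L γ σ m i k x y * T m j x y
    - ∑ m, L γ σ m j k x y * T i m x y

/-- `T_ij|_k` for a tensor field of type `(0, 2)`. -/
def vCov2 {n : ℕ} (γ : Coord n → Matrix (Fin n) (Fin n) ℝ) (σ : Fn n)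
    (T : Fin n → Fin n → Fn n) (i j k : Fin n) : Fn n :=
  fun x y => dy k (T i j) x y - ∑ m, C γ σ m i k x y * T m j x y
    - ∑ m, C γ σ m j k x y * T i m x y

/-! ### Electromagnetic tensors -/

/-- The Liouville vector field `y^i ∂/∂y^i`, given by its components. -/
def liouville {n : ℕ} (i : Fin n) : Fn n := fun _ y => y i

/-- The `h`-deflection tensor `D_ij = g_im y^m_{|j}`. -/
def hDefl {n : ℕ} (γ : Coord n → Matrix (Fin n) (Fin n) ℝ) (σ : Fn n) (i j : Fin n) : Fn n :=
  fun x y => ∑ m, g γ σ x y i m * hCovVec γ σ liouville m j x y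

/-- The `v`-deflection tensor `d_ij = g_im y^m|_j`. -/
def vDefl {n : ℕ} (γ : Coord n → Matrix (Fin n) (Fin n) ℝ) (σ : Fn n) (i j : Fin n) : Fn n :=
  fun x y => ∑ m, g γ σ x y i m * vCovVec γ σ liouville m j x y

/-- The `h`-electromagnetic tensor `F_ij = ½ (D_ij - D_ji)`. -/
def F {n : ℕ} (γ : Coord n → Matrix (Fin n) (Fin n) ℝ) (σ : Fn n) (i j : Fin n) : Fn n :=
  fun x y => (1 / 2) * (hDefl γ σ i j x y - hDefl γ σ j i x y)

/-- The `v`-electromagnetic tensor `f_ij = ½ (d_ij - d_ji)`. -/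
def f {n : ℕ} (γ : Coord n → Matrix (Fin n) (Fin n) ℝ) (σ : Fn n) (i j : Fin n) : Fn n :=
  fun x y => (1 / 2) * (vDefl γ σ i j x y - vDefl γ σ j i x y)

/-- The cyclic sum `∑_(ijk) A_ijk = A_ijk + A_jki + A_kij`. -/
def cyc {n : ℕ} (A : Fin n → Fin n → Fin n → ℝ) (i j k : Fin n) : ℝ :=
  A i j k + A j k i + A k i j

/-! ### Curvatures and Einstein equations of the canonical metrical connection -/

/-- The `h`-curvature `R^i_hjk = δL^i_hj/δx^k - δL^i_hk/δx^j + L^s_hj L^i_sk - L^s_hk L^i_sj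
+ C^i_hs R^s_jk`; `hCurv γ σ i h j k` is `R^i_hjk`. -/
def hCurv {n : ℕ} (γ : Coord n → Matrix (Fin n) (Fin n) ℝ) (σ : Fn n) (i h j k : Fin n) :
    Fn n := fun x y =>
  delta γ k (L γ σ i h j) x y - delta γ j (L γ σ i h k) x y +
    ∑ s, (L γ σ s h j x y * L γ σ i s k x y - L γ σ s h k x y * L γ σ i s j x y) +
    ∑ s, C γ σ i h s x y * curvN γ s j k x y

/-- The `v`-curvature `S^i_hjk = ∂C^i_hj/∂y^k - ∂C^i_hk/∂y^j + C^s_hj C^i_sk - C^s_hk C^i_sj`;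
`vCurv γ σ i h j k` is `S^i_hjk`. -/
def vCurv {n : ℕ} (γ : Coord n → Matrix (Fin n) (Fin n) ℝ) (σ : Fn n) (i h j k : Fin n) :
    Fn n := fun x y =>
  dy k (C γ σ i h j) x y - dy j (C γ σ i h k) x y +
    ∑ s, (C γ σ s h j x y * C γ σ i s k x y - C γ σ s h k x y * C γ σ i s j x y)

/-- `R_ij = R^k_ijk`. -/
def hRic {n : ℕ} (γ : Coord n → Matrix (Fin n) (Fin n) ℝ) (σ : Fn n) (i j : Fin n) : Fn n :=
  fun x y => ∑ k, hCurv γ σ k i j k x y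

/-- `S_ab = S^c_abc`. -/
def vRic {n : ℕ} (γ : Coord n → Matrix (Fin n) (Fin n) ℝ) (σ : Fn n) (a b : Fin n) : Fn n :=
  fun x y => ∑ c, vCurv γ σ c a b c x y

/-- `R = g^ij R_ij`. -/
def hScal {n : ℕ} (γ : Coord n → Matrix (Fin n) (Fin n) ℝ) (σ : Fn n) : Fn n :=
  fun x y => ∑ i, ∑ j, (g γ σ x y)⁻¹ i j * hRic γ σ i j x y

/-- `S = g^ab S_ab`. -/
def vScal {n : ℕ} (γ : Coord n → Matrix (Fin n) (Fin n) ℝ) (σ : Fn n) : Fn n :=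
  fun x y => ∑ a, ∑ b, (g γ σ x y)⁻¹ a b * vRic γ σ a b x y

/-- The Einstein equations at `(x, y)` of the space with metric `g_ij`, endowed with its canonical
metrical connection: `R_ij - ½ R g_ij = 𝒦 T^H_ij` and `S_ab - ½ S g_ab = 𝒦 T^V_ab`. -/
def EinsteinEquations {n : ℕ} (γ : Coord n → Matrix (Fin n) (Fin n) ℝ) (σ : Fn n) (κ : ℝ)
    (TH TV : Fin n → Fin n → Fn n) (x y : Coord n) : Prop :=
  (∀ i j, hRic γ σ i j x y - (1 / 2) * hScal γ σ x y * g γ σ x y i j = κ * TH i j x y) ∧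
  (∀ a b, vRic γ σ a b x y - (1 / 2) * vScal γ σ x y * g γ σ x y a b = κ * TV a b x y)

/-! ### The quantities built from `σ` -/

/-- `σ_i = δσ/δx^i`. -/
def sh {n : ℕ} (γ : Coord n → Matrix (Fin n) (Fin n) ℝ) (σ : Fn n) (i : Fin n) : Fn n :=
  delta γ i σ

/-- `σ̇_a = ∂σ/∂y^a`. -/
def sv {n : ℕ} (σ : Fn n) (a : Fin n) : Fn n := dy a σ

/-- `σ^H = γ^kl σ_k σ_l`. -/
def sigmaH {n : ℕ} (γ : Coord n → Matrix (Fin n) (Fin n) ℝ) (σ : Fn n) : Fn n :=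
  fun x y => ∑ k, ∑ l, (γ x)⁻¹ k l * sh γ σ k x y * sh γ σ l x y

/-- `σ^V = γ^ab σ̇_a σ̇_b`. -/
def sigmaV {n : ℕ} (γ : Coord n → Matrix (Fin n) (Fin n) ℝ) (σ : Fn n) : Fn n :=
  fun x y => ∑ a, ∑ b, (γ x)⁻¹ a b * sv σ a x y * sv σ b x y

/-- `σ_ij = σ_{i|j} + σ_i σ_j - ½ γ_ij σ^H`. -/
def sh2 {n : ℕ} (γ : Coord n → Matrix (Fin n) (Fin n) ℝ) (σ : Fn n) (i j : Fin n) : Fn n :=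
  fun x y => hCov1 γ σ (sh γ σ) i j x y + sh γ σ i x y * sh γ σ j x y
    - γ x i j * sigmaH γ σ x y / 2

/-- `σ̇_ab = σ̇_a|_b + σ̇_a σ̇_b - ½ γ_ab σ^V`. -/
def sv2 {n : ℕ} (γ : Coord n → Matrix (Fin n) (Fin n) ℝ) (σ : Fn n) (a b : Fin n) : Fn n :=
  fun x y => vCov1 γ σ (sv σ) a b x y + sv σ a x y * sv σ b x y
    - γ x a b * sigmaV γ σ x y / 2

/-- `σ̄ = γ^ij σ_ij`. -/
def sigmaBar {n : ℕ} (γ : Coord n → Matrix (Fin n) (Fin n) ℝ) (σ : Fn n) : Fn n :=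
  fun x y => ∑ i, ∑ j, (γ x)⁻¹ i j * sh2 γ σ i j x y

/-- `σ̇ = γ^ab σ̇_ab`. -/
def sigmaDot {n : ℕ} (γ : Coord n → Matrix (Fin n) (Fin n) ℝ) (σ : Fn n) : Fn n :=
  fun x y => ∑ a, ∑ b, (γ x)⁻¹ a b * sv2 γ σ a b x y

/-- The correction tensor
`t_ij = (n-2)(γ_ij σ̄ - σ_ij) - γ_ij r_st y^s γ^tp σ̇_p + σ̇_i r^a_tja y^t
  - γ_is γ^ap σ̇_p r^s_tja y^t`. -/
def corr {n : ℕ} (γ : Coord n → Matrix (Fin n) (Fin n) ℝ) (σ : Fn n) (i j : Fin n) : Fn n :=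
  fun x y =>
    ((n : ℝ) - 2) * (γ x i j * sigmaBar γ σ x y - sh2 γ σ i j x y)
    - γ x i j * ∑ s, ∑ t, ∑ p, rRic γ s t x * y s * (γ x)⁻¹ t p * sv σ p x y
    + sv σ i x y * ∑ a, ∑ t, rCurv γ a t j a x * y t
    - ∑ s, ∑ a, ∑ p, ∑ t, γ x i s * (γ x)⁻¹ a p * sv σ p x y * rCurv γ s t j a x * y t

end

end GenLagrange

/-!
In an induced chart the operators `δ/δx^i` and `∂/∂y^a` are two families of derivations of the
smooth functions of `(x, y)`. The coefficients `L` and `C` are given by one and the same formula,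
`conn`, applied to these two families and to the metric `g = e^{2σ} γ`, and the curvatures by one
formula, `curv`. For any family of derivations `D_i`, commuting or not, the classical computation
of the conformal change applies: `IsMetric.conn_conformal` gives the connection of `e^{2σ} G`, and
`IsMetric.curv_conformal` its curvature, where the failure of the `D_i` to commute leaves the
single extra term `δ^i_h [D_k, D_j]σ`.

For `δ/δx^i` the connection of `γ` is given by its Christoffel symbols, and `[δ/δx^k, δ/δx^j] =
-R^m_jk ∂/∂y^m` with `R^m_jk = r^m_qjk y^q` (`IsMetric.delta_comm`, `IsMetric.curvN_eq`). Part of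
the torsion term `C^i_hs R^s_jk` of the `h`-curvature cancels the extra term, and the rest
survives as the terms of `t_ij` with `σ̇` (`IsMetric.hCurv_eq`). For `∂/∂y^a` the connection of
`γ` is zero and the derivations commute (`IsMetric.vCurv_eq`). The two left-hand sides of the
Einstein equations are then the claimed ones identically (`IsMetric.einstein_h`,
`IsMetric.einstein_v`), from which the equivalence follows.

For the Maxwell equations, `F_ij = Y_i σ_j - Y_j σ_i` and `f_ij = Y_i σ̇_j - Y_j σ̇_i` with `Y_i =
g_ip y^p` (`IsMetric.skew_deflection`). In the cyclic sums the symmetric coefficients `L`, `C`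
cancel (`cyc_cov_skew`), so only derivatives of `Y`, `σ_i`, `σ̇_a` remain. The skew part of `D_j
Y_k` is `2 (w_j Y_k - w_k Y_j)` with `w = Dσ` (`IsMetric.der_lowerLiouville`); its contributions
cancel within the sums in the pure equations and between the two sides in the mixed one. The
derivatives of `σ_i`, `σ̇_a` enter through the commutators of the derivations.
-/

namespace GenLagrange

variable {n : ℕ}

/-! ### Components in a chart of the maximal atlas -/

section Charts

variable {M : Type*} [TopologicalSpace M] [ChartedSpace (Coord n) M]
  [IsManifold (𝓡 n) ∞ M]

/-- `(x, y) ↦ y^i ∂/∂x^i` is smooth, being the tangent map of `e.symm`. -/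
theorem contMDiffOn_tangentPoint {e : OpenPartialHomeomorph M (Coord n)}
    (he : e ∈ IsManifold.maximalAtlas (𝓡 n) ∞ M) :
    ContMDiffOn (𝓘(ℝ, Coord n × Coord n)) (𝓡 n).tangent ∞
      (fun p : Coord n × Coord n => tangentPoint e p.1 p.2) (e.target ×ˢ Set.univ) := by
  have h1 := contMDiffOn_symm_of_mem_maximalAtlas he
  have h2 := h1.contMDiffOn_tangentMapWithin (m := ∞) (by simp) e.open_target.uniqueMDiffOn
  have h3 : ContMDiff (𝓘(ℝ, Coord n × Coord n)) (𝓡 n).tangent ∞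
      (fun p : Coord n × Coord n => (⟨p.1, p.2⟩ : TangentBundle (𝓡 n) (Coord n))) := by
    intro p
    rw [Bundle.contMDiffAt_totalSpace]
    refine ⟨contDiff_fst.contMDiff.contMDiffAt, ?_⟩
    refine (contDiff_snd.contMDiff.contMDiffAt (x := p)).congr_of_eventuallyEq ?_
    filter_upwards with q
    simp
  refine (h2.comp (h3.contMDiffOn (s := e.target ×ˢ Set.univ)) ?_).congr ?_
  · rintro p hp
    exact hp.1
  · rintro p hp
    simp only [Function.comp, tangentMapWithin, tangentPoint]
    rw [mfderivWithin_of_isOpen e.open_target hp.1]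

theorem contDiffOn_localFn {U : Set (TangentBundle (𝓡 n) M)}
    {σ : TangentBundle (𝓡 n) M → ℝ}
    (hσ : ContMDiffOn (𝓡 n).tangent 𝓘(ℝ, ℝ) ∞ σ U)
    {e : OpenPartialHomeomorph M (Coord n)} (he : e ∈ IsManifold.maximalAtlas (𝓡 n) ∞ M) :
    ContDiffOn ℝ ∞ (fun p : Coord n × Coord n => localFn σ e p.1 p.2)
      (e.target ×ˢ Set.univ ∩ (fun p : Coord n × Coord n => tangentPoint e p.1 p.2) ⁻¹' U) := by
  rw [← contMDiffOn_iff_contDiffOn]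
  exact hσ.comp ((contMDiffOn_tangentPoint he).mono Set.inter_subset_left) fun p hp => hp.2

theorem isOpen_chartDomain {U : Set (TangentBundle (𝓡 n) M)} (hU : IsOpen U)
    {e : OpenPartialHomeomorph M (Coord n)} (he : e ∈ IsManifold.maximalAtlas (𝓡 n) ∞ M) :
    IsOpen (e.target ×ˢ (Set.univ : Set (Coord n)) ∩
      (fun p : Coord n × Coord n => tangentPoint e p.1 p.2) ⁻¹' U) :=
  (contMDiffOn_tangentPoint he).continuousOn.isOpen_inter_preimage
    (e.open_target.prod isOpen_univ) hU

variable (γ : Bundle.ContMDiffRiemannianMetric (𝓡 n) ∞ (Coord n)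
  (fun p : M => TangentSpace (𝓡 n) p))

theorem contDiffOn_localMetric {e : OpenPartialHomeomorph M (Coord n)}
    (he : e ∈ IsManifold.maximalAtlas (𝓡 n) ∞ M) (i j : Fin n) :
    ContDiffOn ℝ ∞ (fun x => localMetric γ e x i j) e.target := by
  have h1 := contMDiffOn_symm_of_mem_maximalAtlas he
  have hv (i : Fin n) : ContMDiffOn (𝓡 n) (𝓡 n).tangent ∞
      (fun x : Coord n => tangentPoint e x (EuclideanSpace.single i (1 : ℝ))) e.target :=
    (contMDiffOn_tangentPoint he).comp
      (f := fun x : Coord n => (x, (EuclideanSpace.single i (1 : ℝ) : Coord n)))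
      (contDiff_id.prodMk contDiff_const).contMDiff.contMDiffOn
      fun x hx => ⟨hx, trivial⟩
  have hg := γ.contMDiff.comp_contMDiffOn h1
  -- A scalar function is treated as a section of the trivial line bundle.
  have := ContMDiffOn.clm_bundle_apply₂ (F₁ := Coord n) (F₂ := Coord n) (F₃ := ℝ)
    (E₃ := fun _ : M => ℝ) hg (hv i) (hv j)
  intro x hx
  have h2 := this x hx
  rw [Bundle.contMDiffWithinAt_totalSpace] at h2
  exact h2.2.contDiffWithinAt

theorem localMetric_symm (e : OpenPartialHomeomorph M (Coord n)) (x : Coord n) (i j : Fin n) :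
    localMetric γ e x i j = localMetric γ e x j i :=
  γ.symm _ _ _

/-- A vector in the kernel of the matrix `γ_ij(x)` would be a nonzero tangent vector of length `0`,
as the derivative of `e.symm` is injective. -/
theorem det_localMetric_ne_zero {e : OpenPartialHomeomorph M (Coord n)}
    (he : e ∈ IsManifold.maximalAtlas (𝓡 n) ∞ M) {x : Coord n} (hx : x ∈ e.target) :
    (localMetric γ e x).det ≠ 0 := by
  intro hdet
  obtain ⟨v, hv0, hv⟩ := Matrix.exists_mulVec_eq_zero_iff.2 hdet
  set D := mfderiv (𝓡 n) (𝓡 n) e.symm x with hD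
  set w : Coord n := ∑ i, v i • (EuclideanSpace.single i (1 : ℝ) : Coord n) with hw
  have hwi (i : Fin n) : w i = v i := by
    simp [hw, Finset.sum_apply, Pi.single_apply]
  have hinj : Function.Injective D := by
    have hd : e.MDifferentiable (𝓡 n) (𝓡 n) :=
      ⟨(contMDiffOn_of_mem_maximalAtlas he).mdifferentiableOn (by simp),
        (contMDiffOn_symm_of_mem_maximalAtlas he).mdifferentiableOn (by simp)⟩
    exact hd.symm.mfderiv_injective hx
  have hDw : D w ≠ 0 := by
    intro h
    have : w = 0 := hinj (h.trans (map_zero D).symm)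
    apply hv0
    ext i
    rw [← hwi, this]; rfl
  have hpos := γ.pos _ _ hDw
  have hzero : γ.inner (e.symm x) (D w) (D w) = ∑ i, v i * ∑ j, localMetric γ e x i j * v j := by
    have hsum : D w = ∑ i, v i • D (EuclideanSpace.single i (1 : ℝ) : Coord n) := by
      rw [hw]
      exact (map_sum D _ _).trans (Finset.sum_congr rfl fun i _ => map_smul D _ _)
    rw [hsum]
    simp only [map_sum, map_smul, sum_apply, smul_apply,
      smul_eq_mul, localMetric, Matrix.of_apply, Finset.mul_sum]
    rw [Finset.sum_comm]
    refine Finset.sum_congr rfl fun i _ => Finset.sum_congr rfl fun j _ => ?_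
    ring
  rw [hzero] at hpos
  have : ∀ i, ∑ j, localMetric γ e x i j * v j = 0 := fun i => congrFun hv i
  simp [this] at hpos

end Charts

/-! ### Smooth functions of `(x, y)` and derivations -/

/-- Smoothness on `V` of a function of the coordinates `(x, y)`. -/
def IsSmooth (V : Set (Coord n × Coord n)) (f : Fn n) : Prop :=
  ContDiffOn ℝ ∞ (fun p : Coord n × Coord n => f p.1 p.2) V

namespace IsSmooth

variable {V : Set (Coord n × Coord n)} {f g : Fn n}

theorem const (c : ℝ) : IsSmooth V (fun _ _ => c) := contDiffOn_const

theorem add (hf : IsSmooth V f) (hg : IsSmooth V g) : IsSmooth V (fun x y => f x y + g x y) :=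
  ContDiffOn.add hf hg

theorem sub (hf : IsSmooth V f) (hg : IsSmooth V g) : IsSmooth V (fun x y => f x y - g x y) :=
  ContDiffOn.sub hf hg

theorem mul (hf : IsSmooth V f) (hg : IsSmooth V g) : IsSmooth V (fun x y => f x y * g x y) :=
  ContDiffOn.mul hf hg

theorem sum {ι : Type*} {s : Finset ι} {F : ι → Fn n} (h : ∀ i ∈ s, IsSmooth V (F i)) :
    IsSmooth V (fun x y => ∑ i ∈ s, F i x y) :=
  ContDiffOn.sum h

theorem prod {ι : Type*} {s : Finset ι} {F : ι → Fn n} (h : ∀ i ∈ s, IsSmooth V (F i)) :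
    IsSmooth V (fun x y => ∏ i ∈ s, F i x y) :=
  contDiffOn_prod h

theorem exp (hf : IsSmooth V f) : IsSmooth V (fun x y => Real.exp (f x y)) :=
  ContDiffOn.exp hf

theorem congr (hf : IsSmooth V f) (h : ∀ x y, (x, y) ∈ V → g x y = f x y) : IsSmooth V g :=
  ContDiffOn.congr hf fun p hp => h p.1 p.2 hp

theorem liouville (i : Fin n) : IsSmooth V (liouville i) :=
  ((EuclideanSpace.proj i : Coord n →L[ℝ] ℝ).contDiff.comp contDiff_snd).contDiffOn

theorem differentiableAt (hf : IsSmooth V f) (hV : IsOpen V) {p : Coord n × Coord n}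
    (hp : p ∈ V) : DifferentiableAt ℝ (fun p : Coord n × Coord n => f p.1 p.2) p :=
  (hf.contDiffAt (hV.mem_nhds hp)).differentiableAt (by simp)

theorem det {A : Coord n → Coord n → Matrix (Fin n) (Fin n) ℝ}
    (hA : ∀ i j, IsSmooth V (fun x y => A x y i j)) : IsSmooth V (fun x y => (A x y).det) := by
  simp only [Matrix.det_apply']
  exact sum fun τ _ => (const _).mul (prod fun i _ => hA _ _)

theorem inv {A : Coord n → Coord n → Matrix (Fin n) (Fin n) ℝ}
    (hA : ∀ i j, IsSmooth V (fun x y => A x y i j)) (hdet : ∀ x y, (x, y) ∈ V → (A x y).det ≠ 0)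
    (i j : Fin n) : IsSmooth V (fun x y => (A x y)⁻¹ i j) := by
  simp only [Matrix.inv_def, Ring.inverse_eq_inv', Matrix.smul_apply, smul_eq_mul,
    Matrix.adjugate_apply]
  refine IsSmooth.mul (ContDiffOn.inv (det hA) fun p hp => hdet p.1 p.2 hp) (det fun a b => ?_)
  by_cases h : a = j
  · subst h
    simpa using const _
  · simpa [Matrix.updateRow_ne h] using hA a b

end IsSmooth

/-- `D` acts on the functions that are smooth on `V` as the derivative along a smooth vector
field on `V`. -/
def IsDerivation (V : Set (Coord n × Coord n)) (D : Fn n → Fn n) : Prop :=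
  ∃ X : Coord n × Coord n → Coord n × Coord n, ContDiffOn ℝ ∞ X V ∧
    ∀ f, IsSmooth V f → ∀ x y, (x, y) ∈ V →
      D f x y = fderiv ℝ (fun p : Coord n × Coord n => f p.1 p.2) (x, y) (X (x, y))

namespace IsDerivation

variable {V : Set (Coord n × Coord n)} {D : Fn n → Fn n} {f g : Fn n} {x y : Coord n}

theorem smooth (hD : IsDerivation V D) (hV : IsOpen V) (hf : IsSmooth V f) :
    IsSmooth V (D f) := by
  obtain ⟨X, hX, h⟩ := hD
  refine ContDiffOn.congr (f := fun p =>
    fderiv ℝ (fun p : Coord n × Coord n => f p.1 p.2) p (X p)) ?_ fun p hp => h f hf p.1 p.2 hp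
  exact (hf.fderiv_of_isOpen hV (by simp)).clm_apply hX

theorem congr (hD : IsDerivation V D) (hV : IsOpen V) (hf : IsSmooth V f)
    (h : ∀ x y, (x, y) ∈ V → g x y = f x y) (hp : (x, y) ∈ V) : D g x y = D f x y := by
  obtain ⟨X, -, hX⟩ := hD
  rw [hX f hf x y hp, hX g (hf.congr h) x y hp]
  congr 1
  apply Filter.EventuallyEq.fderiv_eq
  filter_upwards [hV.mem_nhds hp] with p hp using h p.1 p.2 hp

theorem const (hD : IsDerivation V D) (c : ℝ) (hp : (x, y) ∈ V) : D (fun _ _ => c) x y = 0 := by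
  obtain ⟨X, -, hX⟩ := hD
  simp [hX _ (IsSmooth.const c) x y hp]

theorem add (hD : IsDerivation V D) (hV : IsOpen V) (hf : IsSmooth V f) (hg : IsSmooth V g)
    (hp : (x, y) ∈ V) : D (fun x y => f x y + g x y) x y = D f x y + D g x y := by
  obtain ⟨X, -, hX⟩ := hD
  rw [hX _ (hf.add hg) x y hp, hX _ hf x y hp, hX _ hg x y hp,
    fderiv_fun_add (hf.differentiableAt hV hp) (hg.differentiableAt hV hp)]
  rfl

theorem sub (hD : IsDerivation V D) (hV : IsOpen V) (hf : IsSmooth V f) (hg : IsSmooth V g)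
    (hp : (x, y) ∈ V) : D (fun x y => f x y - g x y) x y = D f x y - D g x y := by
  obtain ⟨X, -, hX⟩ := hD
  rw [hX _ (hf.sub hg) x y hp, hX _ hf x y hp, hX _ hg x y hp,
    fderiv_fun_sub (hf.differentiableAt hV hp) (hg.differentiableAt hV hp)]
  rfl

theorem mul (hD : IsDerivation V D) (hV : IsOpen V) (hf : IsSmooth V f) (hg : IsSmooth V g)
    (hp : (x, y) ∈ V) :
    D (fun x y => f x y * g x y) x y = D f x y * g x y + f x y * D g x y := by
  obtain ⟨X, -, hX⟩ := hD
  rw [hX _ (hf.mul hg) x y hp, hX _ hf x y hp, hX _ hg x y hp,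
    fderiv_fun_mul (hf.differentiableAt hV hp) (hg.differentiableAt hV hp)]
  simp only [add_apply, smul_apply, smul_eq_mul]
  ring

theorem sum (hD : IsDerivation V D) (hV : IsOpen V) {ι : Type*} {s : Finset ι} {F : ι → Fn n}
    (hF : ∀ i ∈ s, IsSmooth V (F i)) (hp : (x, y) ∈ V) :
    D (fun x y => ∑ i ∈ s, F i x y) x y = ∑ i ∈ s, D (F i) x y := by
  obtain ⟨X, -, hX⟩ := hD
  rw [hX _ (IsSmooth.sum hF) x y hp,
    fderiv_fun_sum fun i hi => (hF i hi).differentiableAt hV hp, sum_apply]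
  exact Finset.sum_congr rfl fun i hi => (hX _ (hF i hi) x y hp).symm

theorem const_mul (hD : IsDerivation V D) (hV : IsOpen V) (c : ℝ) (hf : IsSmooth V f)
    (hp : (x, y) ∈ V) : D (fun x y => c * f x y) x y = c * D f x y := by
  rw [hD.mul hV (.const c) hf hp, hD.const c hp]
  ring

theorem exp (hD : IsDerivation V D) (hV : IsOpen V) (hf : IsSmooth V f) (hp : (x, y) ∈ V) :
    D (fun x y => Real.exp (f x y)) x y = Real.exp (f x y) * D f x y := by
  obtain ⟨X, -, hX⟩ := hD
  rw [hX _ hf.exp x y hp, hX _ hf x y hp, fderiv_exp (hf.differentiableAt hV hp)]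
  rfl

end IsDerivation

section Partial

variable {V : Set (Coord n × Coord n)} {f : Fn n} {x y : Coord n}

theorem dx_eq_fderiv (hV : IsOpen V) (hf : IsSmooth V f) (i : Fin n) (hp : (x, y) ∈ V) :
    dx i f x y = fderiv ℝ (fun p : Coord n × Coord n => f p.1 p.2) (x, y)
      (EuclideanSpace.single i 1, 0) := by
  have h := (hf.differentiableAt hV hp).hasFDerivAt
  have h2 := h.comp (f := fun x' : Coord n => (x', y)) x
    ((hasFDerivAt_id x).prodMk (hasFDerivAt_const y x))
  have h3 : HasFDerivAt (fun x' => f x' y) _ x := h2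
  rw [dx, pd, h3.fderiv]
  rfl

theorem dy_eq_fderiv (hV : IsOpen V) (hf : IsSmooth V f) (i : Fin n) (hp : (x, y) ∈ V) :
    dy i f x y = fderiv ℝ (fun p : Coord n × Coord n => f p.1 p.2) (x, y)
      (0, EuclideanSpace.single i 1) := by
  have h := (hf.differentiableAt hV hp).hasFDerivAt
  have h2 := h.comp (f := fun y' : Coord n => (x, y')) y
    ((hasFDerivAt_const x y).prodMk (hasFDerivAt_id y))
  have h3 : HasFDerivAt (f x) _ y := h2
  rw [dy, pd, h3.fderiv]
  rfl

theorem isDerivation_dx (hV : IsOpen V) (i : Fin n) : IsDerivation V (dx i) :=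
  ⟨fun _ => (EuclideanSpace.single i 1, 0), contDiffOn_const,
    fun _ hf _ _ hp => dx_eq_fderiv hV hf i hp⟩

theorem isDerivation_dy (hV : IsOpen V) (i : Fin n) : IsDerivation V (dy i) :=
  ⟨fun _ => (0, EuclideanSpace.single i 1), contDiffOn_const,
    fun _ hf _ _ hp => dy_eq_fderiv hV hf i hp⟩

/-- Derivations along constant vector fields commute, by the symmetry of second derivatives. -/
theorem derivation_comm (hV : IsOpen V) (hf : IsSmooth V f) {D D' : Fn n → Fn n}
    {v v' : Coord n × Coord n}
    (hD : ∀ f, IsSmooth V f → ∀ x y, (x, y) ∈ V →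
      D f x y = fderiv ℝ (fun p : Coord n × Coord n => f p.1 p.2) (x, y) v)
    (hD' : ∀ f, IsSmooth V f → ∀ x y, (x, y) ∈ V →
      D' f x y = fderiv ℝ (fun p : Coord n × Coord n => f p.1 p.2) (x, y) v')
    (hp : (x, y) ∈ V) : D (D' f) x y = D' (D f) x y := by
  have hsm {E : Fn n → Fn n} {w : Coord n × Coord n}
      (hE : ∀ f, IsSmooth V f → ∀ x y, (x, y) ∈ V →
        E f x y = fderiv ℝ (fun p : Coord n × Coord n => f p.1 p.2) (x, y) w) :
      IsSmooth V (E f) := IsDerivation.smooth ⟨fun _ => w, contDiffOn_const, hE⟩ hV hf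
  have key {E : Fn n → Fn n} {w : Coord n × Coord n}
      (hE : ∀ f, IsSmooth V f → ∀ x y, (x, y) ∈ V →
        E f x y = fderiv ℝ (fun p : Coord n × Coord n => f p.1 p.2) (x, y) w)
      (u : Coord n × Coord n) :
      fderiv ℝ (fun p : Coord n × Coord n => E f p.1 p.2) (x, y) u =
        fderiv ℝ (fderiv ℝ (fun p : Coord n × Coord n => f p.1 p.2)) (x, y) u w := by
    have h1 : (fun p : Coord n × Coord n => E f p.1 p.2) =ᶠ[nhds (x, y)]
        fun p => fderiv ℝ (fun p : Coord n × Coord n => f p.1 p.2) p w := by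
      filter_upwards [hV.mem_nhds hp] with p hp using hE f hf p.1 p.2 hp
    have h2 : DifferentiableAt ℝ (fderiv ℝ (fun p : Coord n × Coord n => f p.1 p.2)) (x, y) :=
      ((hf.fderiv_of_isOpen (m := ∞) hV (by simp)).contDiffAt
        (hV.mem_nhds hp)).differentiableAt (by simp)
    rw [h1.fderiv_eq, fderiv_clm_apply h2 (differentiableAt_const w)]
    simp
  rw [hD _ (hsm hD') x y hp, hD' _ (hsm hD) x y hp, key hD', key hD]
  exact (hf.contDiffAt (hV.mem_nhds hp)).isSymmSndFDerivAt
    (by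
      rw [minSmoothness_of_isRCLikeNormedField]
      exact WithTop.coe_le_coe.2 (le_top : (2 : ℕ∞) ≤ ⊤)) v v'

theorem dx_dx_comm (hV : IsOpen V) (hf : IsSmooth V f) (i j : Fin n) (hp : (x, y) ∈ V) :
    dx i (dx j f) x y = dx j (dx i f) x y :=
  derivation_comm hV hf (fun _ hf _ _ hp => dx_eq_fderiv hV hf i hp)
    (fun _ hf _ _ hp => dx_eq_fderiv hV hf j hp) hp

theorem dx_dy_comm (hV : IsOpen V) (hf : IsSmooth V f) (i j : Fin n) (hp : (x, y) ∈ V) :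
    dx i (dy j f) x y = dy j (dx i f) x y :=
  derivation_comm hV hf (fun _ hf _ _ hp => dx_eq_fderiv hV hf i hp)
    (fun _ hf _ _ hp => dy_eq_fderiv hV hf j hp) hp

theorem dy_dy_comm (hV : IsOpen V) (hf : IsSmooth V f) (i j : Fin n) (hp : (x, y) ∈ V) :
    dy i (dy j f) x y = dy j (dy i f) x y :=
  derivation_comm hV hf (fun _ hf _ _ hp => dy_eq_fderiv hV hf i hp)
    (fun _ hf _ _ hp => dy_eq_fderiv hV hf j hp) hp

end Partial

/-! ### Conformal change of the connection of a metric, for a family of derivations -/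

/-- The coefficients `½ G^ih (D_j G_hk + D_k G_jh - D_h G_jk)` built from a metric `G_ij(x, y)` and
a family of operators `D_i`. -/
noncomputable def conn (D : Fin n → Fn n → Fn n) (G : Coord n → Coord n → Matrix (Fin n) (Fin n) ℝ)
    (i j k : Fin n) : Fn n := fun x y =>
  (1 / 2) * ∑ h, (G x y)⁻¹ i h *
    (D j (fun x' y' => G x' y' h k) x y + D k (fun x' y' => G x' y' j h) x y
      - D h (fun x' y' => G x' y' j k) x y)

/-- The gradient `w^i = G^ij w_j` of a function, `w_j = D_j σ`. -/
noncomputable def grad (D : Fin n → Fn n → Fn n) (G : Coord n → Coord n → Matrix (Fin n) (Fin n) ℝ)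
    (σ : Fn n) (i : Fin n) : Fn n := fun x y => ∑ j, (G x y)⁻¹ i j * D j σ x y

/-- The expression `D_k Λ^i_hj - D_j Λ^i_hk + Λ^s_hj Λ^i_sk - Λ^s_hk Λ^i_sj` in the coefficients
`Λ`, without a torsion term. -/
noncomputable def curv (D : Fin n → Fn n → Fn n) (Λ : Fin n → Fin n → Fin n → Fn n)
    (i h j k : Fin n) : Fn n :=
  fun x y => D k (Λ i h j) x y - D j (Λ i h k) x y +
    ∑ s, (Λ s h j x y * Λ i s k x y - Λ s h k x y * Λ i s j x y)

/-- The tensor `B_hk = D_k w_h - Γ^m_hk w_m - w_h w_k + ½ G_hk |w|²`, where `w = Dσ` and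
`Γ = conn D G`, that governs the conformal change of the curvature. -/
noncomputable def schoutenChange (D : Fin n → Fn n → Fn n)
    (G : Coord n → Coord n → Matrix (Fin n) (Fin n) ℝ) (σ : Fn n) (h k : Fin n) : Fn n :=
  fun x y => D k (D h σ) x y - ∑ m, conn D G m h k x y * D m σ x y - D h σ x y * D k σ x y
    + (1 / 2) * G x y h k * ∑ m, grad D G σ m x y * D m σ x y

theorem conn_symm_of_symm (D : Fin n → Fn n → Fn n)
    {G : Coord n → Coord n → Matrix (Fin n) (Fin n) ℝ}
    (hG : ∀ x y i j, G x y i j = G x y j i) (i j k : Fin n) :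
    conn D G i j k = conn D G i k j := by
  have e (a b : Fin n) : (fun x y => G x y a b) = fun x y => G x y b a :=
    funext₂ fun x y => hG x y a b
  funext x y
  simp only [conn]
  congr 1
  refine Finset.sum_congr rfl fun h _ => ?_
  rw [e h k, e j h, e j k]
  ring

theorem inv_exp_smul {A : Matrix (Fin n) (Fin n) ℝ} (hA : A.det ≠ 0) (c : ℝ) :
    (Real.exp c • A)⁻¹ = (Real.exp c)⁻¹ • A⁻¹ := by
  have := Matrix.inv_smul' A (Units.mk0 _ (Real.exp_pos c).ne') hA.isUnit
  simpa [Units.smul_def] using this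

/-- A metric `G_ij(x, y)` whose components are smooth on the open set `V`, with a family of
derivations `D_i` on `V`. Positivity plays no role, only invertibility is kept. -/
structure IsMetric (V : Set (Coord n × Coord n)) (D : Fin n → Fn n → Fn n)
    (G : Coord n → Coord n → Matrix (Fin n) (Fin n) ℝ) : Prop where
  isOpen : IsOpen V
  der : ∀ k, IsDerivation V (D k)
  smooth : ∀ i j, IsSmooth V (fun x y => G x y i j)
  symm : ∀ x y i j, G x y i j = G x y j i
  det : ∀ x y, (x, y) ∈ V → (G x y).det ≠ 0

/-- The purely algebraic part of the conformal change of the curvature: `Γ + A` with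
`A^i_hj = δ^i_j w_h + δ^i_h w_j - G_hj u^i`, where `DΓ`, `Dw`, `DG`, `Du` are the values of the
derivatives of the corresponding quantities at a point. -/
theorem conformal_curvature_algebra (G : Fin n → Fin n → ℝ) (Γ : Fin n → Fin n → Fin n → ℝ)
    (w u : Fin n → ℝ) (DΓ : Fin n → Fin n → Fin n → Fin n → ℝ) (Dw : Fin n → Fin n → ℝ)
    (DG : Fin n → Fin n → Fin n → ℝ) (Du : Fin n → Fin n → ℝ)
    (hG : ∀ i j, G i j = G j i) (hΓ : ∀ i j k, Γ i j k = Γ i k j)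
    (hu : ∀ a, ∑ i, G a i * u i = w a)
    (hDG : ∀ h j k, DG h j k = ∑ m, Γ m h k * G m j + ∑ m, Γ m j k * G h m)
    (A : Fin n → Fin n → Fin n → ℝ)
    (hA : ∀ i h j, A i h j =
      (if i = j then 1 else 0) * w h + (if i = h then 1 else 0) * w j - G h j * u i)
    (DA : Fin n → Fin n → Fin n → Fin n → ℝ)
    (hDA : ∀ i h j k, DA i h j k = (if i = j then 1 else 0) * Dw h k
      + (if i = h then 1 else 0) * Dw j k - (DG h j k * u i + G h j * Du i k))
    (B : Fin n → Fin n → ℝ)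
    (hB : ∀ h k, B h k = Dw h k - ∑ m, Γ m h k * w m - w h * w k
      + (1 / 2) * G h k * ∑ m, u m * w m)
    (Bu : Fin n → Fin n → ℝ)
    (hBu : ∀ i k, Bu i k = Du i k + ∑ s, Γ i s k * u s - u i * w k
      + (1 / 2) * (if i = k then 1 else 0) * ∑ m, u m * w m)
    (i h j k : Fin n) :
    (DΓ i h j k + DA i h j k) - (DΓ i h k j + DA i h k j)
      + ∑ s, ((Γ s h j + A s h j) * (Γ i s k + A i s k)
        - (Γ s h k + A s h k) * (Γ i s j + A i s j)) =
    DΓ i h j k - DΓ i h k j + ∑ s, (Γ s h j * Γ i s k - Γ s h k * Γ i s j)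
      + (if i = j then 1 else 0) * B h k - (if i = k then 1 else 0) * B h j
      - G h j * Bu i k + G h k * Bu i j + (if i = h then 1 else 0) * (Dw j k - Dw k j) := by
  have hΓA (a b k : Fin n) : ∑ s, Γ s a b * A i s k =
      (if i = k then 1 else 0) * (∑ s, Γ s a b * w s) + Γ i a b * w k
        - u i * ∑ s, Γ s a b * G s k := by
    have e (s : Fin n) : Γ s a b * A i s k = (if i = k then 1 else 0) * (Γ s a b * w s)
        + (if i = s then Γ s a b * w k else 0) - u i * (Γ s a b * G s k) := by
      rw [hA]; split_ifs <;> ring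
    simp only [e, Finset.sum_sub_distrib, Finset.sum_add_distrib, ← Finset.mul_sum,
      Finset.sum_ite_eq, Finset.mem_univ, if_true]
  have hAX (X : Fin n → ℝ) (a b : Fin n) : ∑ s, A s a b * X s =
      X b * w a + X a * w b - G a b * ∑ s, X s * u s := by
    have e (s : Fin n) : A s a b * X s = (if s = b then X s * w a else 0)
        + (if s = a then X s * w b else 0) - G a b * (X s * u s) := by
      rw [hA]; split_ifs <;> ring
    simp only [e, Finset.sum_sub_distrib, Finset.sum_add_distrib, ← Finset.mul_sum,
      Finset.sum_ite_eq', Finset.mem_univ, if_true]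
  have hAu (k : Fin n) : ∑ s, A i s k * u s = (if i = k then 1 else 0) * ∑ s, u s * w s := by
    have e (s : Fin n) : A i s k * u s = (if i = k then 1 else 0) * (u s * w s)
        + (if i = s then u s * w k else 0) - u i * (G k s * u s) := by
      rw [hA, hG s k]; split_ifs <;> ring
    simp only [e, Finset.sum_sub_distrib, Finset.sum_add_distrib, ← Finset.mul_sum,
      Finset.sum_ite_eq, Finset.mem_univ, if_true, hu]
    ring
  have hquad (a b c : Fin n) : ∑ s, (Γ s a b + A s a b) * (Γ i s c + A i s c) =
      ∑ s, Γ s a b * Γ i s c + ∑ s, Γ s a b * A i s c + ∑ s, A s a b * Γ i s c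
        + ∑ s, A s a b * A i s c := by
    simp only [← Finset.sum_add_distrib]
    exact Finset.sum_congr rfl fun s _ => by ring
  rw [Finset.sum_sub_distrib, hquad, hquad, hΓA, hΓA, hAX, hAX, hAX, hAX, hAu, hAu]
  have hcomm (k : Fin n) : ∑ m, Γ m k j * G h m = ∑ m, Γ m k j * G m h :=
    Finset.sum_congr rfl fun m _ => by rw [hG]
  have hcomm' (k : Fin n) : ∑ m, Γ m j k * G h m = ∑ m, Γ m k j * G m h :=
    Finset.sum_congr rfl fun m _ => by rw [hG, hΓ]
  rw [Finset.sum_sub_distrib, hDA, hDA, hDG, hDG, hcomm, hcomm', hB, hB, hBu, hBu, hA, hA, hA, hA,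
    hΓ i k j, hG k j]
  ring

namespace IsMetric

variable {V : Set (Coord n × Coord n)} {D : Fin n → Fn n → Fn n}
  {G : Coord n → Coord n → Matrix (Fin n) (Fin n) ℝ} {σ : Fn n} {x y : Coord n}

theorem sum_inv_mul (hM : IsMetric V D G) (hp : (x, y) ∈ V) (i k : Fin n) :
    ∑ h, (G x y)⁻¹ i h * G x y h k = if i = k then 1 else 0 := by
  rw [← Matrix.mul_apply, Matrix.nonsing_inv_mul _ (hM.det x y hp).isUnit, Matrix.one_apply]

theorem sum_mul_inv (hM : IsMetric V D G) (hp : (x, y) ∈ V) (i k : Fin n) :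
    ∑ h, G x y i h * (G x y)⁻¹ h k = if i = k then 1 else 0 := by
  rw [← Matrix.mul_apply, Matrix.mul_nonsing_inv _ (hM.det x y hp).isUnit, Matrix.one_apply]

theorem inv_symm (hM : IsMetric V D G) (x y : Coord n) (i k : Fin n) :
    (G x y)⁻¹ i k = (G x y)⁻¹ k i := by
  have h : (G x y).transpose = G x y := Matrix.ext fun i j => hM.symm x y j i
  conv_lhs => rw [← h, ← Matrix.transpose_nonsing_inv, Matrix.transpose_apply]

/-- Raising and then lowering an index is the identity. -/
theorem lower_raise (hM : IsMetric V D G) (hp : (x, y) ∈ V) (v : Fin n → ℝ) (a : Fin n) :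
    ∑ i, G x y a i * ∑ j, (G x y)⁻¹ i j * v j = v a := by
  simp only [Finset.mul_sum, ← mul_assoc]
  rw [Finset.sum_comm]
  simp only [← Finset.sum_mul, hM.sum_mul_inv hp, ite_mul, one_mul, zero_mul, Finset.sum_ite_eq,
    Finset.mem_univ, if_true]

theorem raise_lower (hM : IsMetric V D G) (hp : (x, y) ∈ V) (v : Fin n → ℝ) (a : Fin n) :
    ∑ i, (G x y)⁻¹ a i * ∑ j, G x y i j * v j = v a := by
  simp only [Finset.mul_sum, ← mul_assoc]
  rw [Finset.sum_comm]
  simp only [← Finset.sum_mul, hM.sum_inv_mul hp, ite_mul, one_mul, zero_mul, Finset.sum_ite_eq,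
    Finset.mem_univ, if_true]

theorem conn_symm (hM : IsMetric V D G) (i j k : Fin n) : conn D G i j k = conn D G i k j :=
  conn_symm_of_symm D hM.symm i j k

theorem smooth_inv (hM : IsMetric V D G) (i j : Fin n) :
    IsSmooth V (fun x y => (G x y)⁻¹ i j) :=
  IsSmooth.inv hM.smooth hM.det i j

theorem smooth_conn (hM : IsMetric V D G) (i j k : Fin n) : IsSmooth V (conn D G i j k) := by
  have h (k a b : Fin n) : IsSmooth V (D k fun x y => G x y a b) :=
    (hM.der k).smooth hM.isOpen (hM.smooth a b)
  exact (IsSmooth.const _).mul (IsSmooth.sum fun m _ =>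
    (hM.smooth_inv i m).mul (((h _ _ _).add (h _ _ _)).sub (h _ _ _)))

theorem smooth_grad (hM : IsMetric V D G) (hσ : IsSmooth V σ) (i : Fin n) :
    IsSmooth V (grad D G σ i) :=
  IsSmooth.sum fun j _ => (hM.smooth_inv i j).mul ((hM.der j).smooth hM.isOpen hσ)

theorem sum_mul_grad (hM : IsMetric V D G) (hp : (x, y) ∈ V) (a : Fin n) :
    ∑ i, G x y a i * grad D G σ i x y = D a σ x y :=
  hM.lower_raise hp (fun j => D j σ x y) a

theorem lower_conn (hM : IsMetric V D G) (hp : (x, y) ∈ V) (l j k : Fin n) :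
    ∑ m, G x y l m * conn D G m j k x y = (1 / 2) *
      (D j (fun x' y' => G x' y' l k) x y + D k (fun x' y' => G x' y' j l) x y
      - D l (fun x' y' => G x' y' j k) x y) := by
  simp only [conn]
  rw [← hM.lower_raise hp (fun h => D j (fun x' y' => G x' y' h k) x y
    + D k (fun x' y' => G x' y' j h) x y - D h (fun x' y' => G x' y' j k) x y) l, Finset.mul_sum]
  exact Finset.sum_congr rfl fun m _ => by ring

/-- The connection is metrical: `D_k G_hj = Γ^m_hk G_mj + Γ^m_jk G_hm`. -/
theorem metrical (hM : IsMetric V D G) (hp : (x, y) ∈ V) (h j k : Fin n) :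
    D k (fun x y => G x y h j) x y =
      ∑ m, conn D G m h k x y * G x y m j + ∑ m, conn D G m j k x y * G x y h m := by
  have e (a b : Fin n) : (fun x y => G x y a b) = fun x y => G x y b a :=
    funext₂ fun x y => hM.symm x y a b
  have h1 : ∑ m, conn D G m h k x y * G x y m j = ∑ m, G x y j m * conn D G m h k x y :=
    Finset.sum_congr rfl fun m _ => by rw [hM.symm x y m j, mul_comm]
  have h2 : ∑ m, conn D G m j k x y * G x y h m = ∑ m, G x y h m * conn D G m j k x y :=
    Finset.sum_congr rfl fun m _ => mul_comm _ _
  rw [h1, h2, hM.lower_conn hp, hM.lower_conn hp, e j h, e j k, e h k]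
  ring

/-- The conformal change `Γ^i_jk + δ^i_k w_j + δ^i_j w_k - G_jk w^i` of the connection, `w = Dσ`. -/
theorem conn_conformal (hM : IsMetric V D G) (hσ : IsSmooth V σ) (hp : (x, y) ∈ V)
    (i j k : Fin n) :
    conn D (fun x y => Real.exp (2 * σ x y) • G x y) i j k x y =
      conn D G i j k x y + ((if i = k then 1 else 0) * D j σ x y
        + (if i = j then 1 else 0) * D k σ x y - G x y j k * grad D G σ i x y) := by
  have hD (k a b : Fin n) : D k (fun x y => (Real.exp (2 * σ x y) • G x y) a b) x y =
      Real.exp (2 * σ x y) * (2 * D k σ x y * G x y a b + D k (fun x y => G x y a b) x y) := by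
    simp only [Matrix.smul_apply, smul_eq_mul]
    have h2 : IsSmooth V (fun x y => 2 * σ x y) := (IsSmooth.const 2).mul hσ
    rw [(hM.der k).mul hM.isOpen h2.exp (hM.smooth a b) hp,
      (hM.der k).exp hM.isOpen h2 hp, (hM.der k).const_mul hM.isOpen 2 hσ hp]
    ring
  have he : Real.exp (2 * σ x y) ≠ 0 := (Real.exp_pos _).ne'
  have hinv := inv_exp_smul (hM.det x y hp) (2 * σ x y)
  have hsum (h : Fin n) : (Real.exp (2 * σ x y))⁻¹ * (G x y)⁻¹ i h *
      (Real.exp (2 * σ x y) * (2 * D j σ x y * G x y h k + D j (fun x y => G x y h k) x y)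
      + Real.exp (2 * σ x y) * (2 * D k σ x y * G x y j h + D k (fun x y => G x y j h) x y)
      - Real.exp (2 * σ x y) * (2 * D h σ x y * G x y j k + D h (fun x y => G x y j k) x y)) =
      (G x y)⁻¹ i h * (D j (fun x y => G x y h k) x y + D k (fun x y => G x y j h) x y
        - D h (fun x y => G x y j k) x y)
      + (2 * D j σ x y * ((G x y)⁻¹ i h * G x y h k) + 2 * D k σ x y * ((G x y)⁻¹ i h * G x y h j)
        - 2 * G x y j k * ((G x y)⁻¹ i h * D h σ x y)) := by
    rw [hM.symm x y j h]
    field_simp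
    ring
  rw [conn, conn, grad]
  simp only [hinv, Matrix.smul_apply (_)⁻¹, smul_eq_mul] at hD ⊢
  simp only [hD, hsum, Finset.sum_sub_distrib, Finset.sum_add_distrib, ← Finset.mul_sum,
    hM.sum_inv_mul hp]
  ring

/-- The covariant derivative of the gradient is the raised covariant derivative of `w = Dσ`. -/
theorem der_grad (hM : IsMetric V D G) (hσ : IsSmooth V σ) (hp : (x, y) ∈ V) (i k : Fin n) :
    D k (grad D G σ i) x y = ∑ a, (G x y)⁻¹ i a *
      (D k (D a σ) x y - ∑ m, conn D G m a k x y * D m σ x y)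
      - ∑ s, conn D G i s k x y * grad D G σ s x y := by
  have hw (a : Fin n) : IsSmooth V (D a σ) := (hM.der a).smooth hM.isOpen hσ
  have hu := hM.smooth_grad hσ
  -- Differentiating `G_ai w^i = w_a` avoids the derivative of the inverse matrix.
  have key (a : Fin n) : ∑ i, G x y a i *
      (D k (grad D G σ i) x y + ∑ s, conn D G i s k x y * grad D G σ s x y) =
      D k (D a σ) x y - ∑ m, conn D G m a k x y * D m σ x y := by
    have h1 : D k (D a σ) x y = ∑ i, (D k (fun x y => G x y a i) x y * grad D G σ i x y
        + G x y a i * D k (grad D G σ i) x y) := by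
      rw [← (hM.der k).congr hM.isOpen (hw a) (fun x y hp => hM.sum_mul_grad hp a) hp,
        (hM.der k).sum hM.isOpen (fun i _ => (hM.smooth a i).mul (hu i)) hp]
      exact Finset.sum_congr rfl fun i _ =>
        (hM.der k).mul hM.isOpen (hM.smooth a i) (hu i) hp
    have h2 : ∑ i, (∑ m, conn D G m a k x y * G x y m i) * grad D G σ i x y =
        ∑ m, conn D G m a k x y * D m σ x y := by
      simp only [Finset.sum_mul, ← hM.sum_mul_grad (σ := σ) hp, Finset.mul_sum]
      rw [Finset.sum_comm]
      simp only [mul_assoc]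
    have h3 : ∑ i, (∑ m, conn D G m i k x y * G x y a m) * grad D G σ i x y =
        ∑ i, G x y a i * ∑ s, conn D G i s k x y * grad D G σ s x y := by
      simp only [Finset.sum_mul, Finset.mul_sum]
      rw [Finset.sum_comm]
      exact Finset.sum_congr rfl fun i _ => Finset.sum_congr rfl fun s _ => by ring
    rw [h1]
    simp only [hM.metrical hp, add_mul, mul_add, Finset.sum_add_distrib, h2, h3]
    ring
  have h := hM.raise_lower hp
    (fun i => D k (grad D G σ i) x y + ∑ s, conn D G i s k x y * grad D G σ s x y) i
  simp only [key] at h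
  rw [h]
  ring

/-- Conformal change of the curvature. The derivations `D_i` need not commute, which accounts for
the last term. -/
theorem curv_conformal (hM : IsMetric V D G) (hσ : IsSmooth V σ) (hp : (x, y) ∈ V)
    (i h j k : Fin n) :
    curv D (conn D fun x y => Real.exp (2 * σ x y) • G x y) i h j k x y =
      curv D (conn D G) i h j k x y
      + (if i = j then 1 else 0) * schoutenChange D G σ h k x y
      - (if i = k then 1 else 0) * schoutenChange D G σ h j x y
      - G x y h j * ∑ a, (G x y)⁻¹ i a * schoutenChange D G σ a k x y
      + G x y h k * ∑ a, (G x y)⁻¹ i a * schoutenChange D G σ a j x y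
      + (if i = h then 1 else 0) * (D k (D j σ) x y - D j (D k σ) x y) := by
  have hw (a : Fin n) : IsSmooth V (D a σ) := (hM.der a).smooth hM.isOpen hσ
  have hu := hM.smooth_grad hσ
  have hder (i h j k : Fin n) :
      D k (conn D (fun x y => Real.exp (2 * σ x y) • G x y) i h j) x y =
        D k (conn D G i h j) x y + ((if i = j then 1 else 0) * D k (D h σ) x y
          + (if i = h then 1 else 0) * D k (D j σ) x y
          - (D k (fun x y => G x y h j) x y * grad D G σ i x y
            + G x y h j * D k (grad D G σ i) x y)) := by
    have s1 := (IsSmooth.const (V := V) (if i = j then (1 : ℝ) else 0)).mul (hw h)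
    have s2 := (IsSmooth.const (V := V) (if i = h then (1 : ℝ) else 0)).mul (hw j)
    have s3 := (hM.smooth h j).mul (hu i)
    rw [(hM.der k).congr hM.isOpen ((hM.smooth_conn i h j).add ((s1.add s2).sub s3))
        (fun x y hp => hM.conn_conformal hσ hp i h j) hp,
      (hM.der k).add hM.isOpen (hM.smooth_conn i h j) ((s1.add s2).sub s3) hp,
      (hM.der k).sub hM.isOpen (s1.add s2) s3 hp, (hM.der k).add hM.isOpen s1 s2 hp,
      (hM.der k).const_mul hM.isOpen _ (hw h) hp, (hM.der k).const_mul hM.isOpen _ (hw j) hp,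
      (hM.der k).mul hM.isOpen (hM.smooth h j) (hu i) hp]
  have hraise (i k : Fin n) : ∑ a, (G x y)⁻¹ i a * schoutenChange D G σ a k x y =
      D k (grad D G σ i) x y + ∑ s, conn D G i s k x y * grad D G σ s x y
        - grad D G σ i x y * D k σ x y
        + (1 / 2) * (if i = k then 1 else 0) * ∑ m, grad D G σ m x y * D m σ x y := by
    have e (a : Fin n) : (G x y)⁻¹ i a * schoutenChange D G σ a k x y =
        (G x y)⁻¹ i a * (D k (D a σ) x y - ∑ m, conn D G m a k x y * D m σ x y)
        - D k σ x y * ((G x y)⁻¹ i a * D a σ x y)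
        + (1 / 2) * (∑ m, grad D G σ m x y * D m σ x y) * ((G x y)⁻¹ i a * G x y a k) := by
      rw [schoutenChange]; ring
    simp only [e, Finset.sum_sub_distrib, Finset.sum_add_distrib, ← Finset.mul_sum _ _ (D k σ x y),
      ← Finset.mul_sum _ _ ((1 / 2) * ∑ m, grad D G σ m x y * D m σ x y), hM.sum_inv_mul hp]
    rw [hM.der_grad hσ hp, grad]
    ring
  rw [hraise, hraise]
  simp only [curv, hder, hM.conn_conformal hσ hp]
  exact conformal_curvature_algebra (fun i j => G x y i j) (fun i j k => conn D G i j k x y)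
    (fun a => D a σ x y) (fun i => grad D G σ i x y) (fun i h j k => D k (conn D G i h j) x y)
    (fun a k => D k (D a σ) x y) (fun h j k => D k (fun x y => G x y h j) x y)
    (fun i k => D k (grad D G σ i) x y) (hM.symm x y)
    (fun i j k => by rw [hM.conn_symm]) (fun a => hM.sum_mul_grad hp a)
    (fun h j k => hM.metrical hp h j k) _ (fun _ _ _ => rfl) _ (fun _ _ _ _ => rfl)
    (fun h k => schoutenChange D G σ h k x y) (fun _ _ => rfl) _ (fun _ _ => rfl) i h j k

end IsMetric

/-! ### Contraction of the curvature -/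

section Contraction

variable {G Gi : Matrix (Fin n) (Fin n) ℝ} {B : Fin n → Fin n → ℝ} {R : Fin n → Fin n → Fin n → ℝ}
  {v : Fin n → ℝ} {K ρ : Fin n → Fin n → Fin n → Fin n → ℝ}

/-- Contraction `K^k_hjk` of a tensor of the shape of the changed curvature; in the application `B`
is `σ_ij`, `v` is `σ̇_a` and `R` is the curvature of the nonlinear connection. -/
theorem ricci_conformal_algebra (hGi : ∀ i k, ∑ h, Gi i h * G h k = if i = k then 1 else 0)
    (hG : ∀ i j, G i j = G j i)
    (hGis : ∀ i j, Gi i j = Gi j i)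
    (hK : ∀ i h j k, K i h j k = ρ i h j k + (if i = j then 1 else 0) * B h k
      - (if i = k then 1 else 0) * B h j - G h j * ∑ a, Gi i a * B a k
      + G h k * ∑ a, Gi i a * B a j
      + v h * R i j k - (∑ p, Gi i p * v p) * ∑ s, G h s * R s j k) (h j : Fin n) :
    ∑ k, K k h j k = ∑ k, ρ k h j k + (2 - (n : ℝ)) * B h j - G h j * ∑ a, ∑ b, Gi a b * B a b
      + v h * ∑ k, R k j k - ∑ k, (∑ p, Gi k p * v p) * ∑ s, G h s * R s j k := by
  have h1 : ∑ k, G h k * ∑ a, Gi k a * B a j = B h j := by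
    have e (a : Fin n) : ∑ k, G h k * Gi k a = if h = a then 1 else 0 := by
      rw [← (Finset.sum_congr rfl fun k _ => by rw [hG, hGis, mul_comm] :
        ∑ k, Gi a k * G k h = ∑ k, G h k * Gi k a), hGi]
      simp only [eq_comm]
    simp only [Finset.mul_sum, ← mul_assoc]
    rw [Finset.sum_comm]
    simp only [← Finset.sum_mul, e, ite_mul, one_mul, zero_mul, Finset.sum_ite_eq,
      Finset.mem_univ, if_true]
  have h2 : ∑ k, ∑ a, Gi k a * B a k = ∑ a, ∑ b, Gi a b * B a b := by
    rw [Finset.sum_comm]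
    exact Finset.sum_congr rfl fun a _ => Finset.sum_congr rfl fun b _ => by rw [hGis]
  simp only [hK, Finset.sum_sub_distrib, Finset.sum_add_distrib, h1]
  rw [← Finset.mul_sum _ _ (G h j), ← Finset.mul_sum _ _ (v h), h2]
  simp only [ite_mul, one_mul, zero_mul, Finset.sum_ite_eq', Finset.mem_univ, if_true,
    Finset.sum_const, Finset.card_univ, Fintype.card_fin, nsmul_eq_mul]
  ring

/-- Trace of the contracted tensor. Skew-symmetry of `R` makes its two contributions equal, whence
the factor `2`. -/
theorem scalar_conformal_algebra (hGi : ∀ i k, ∑ h, Gi i h * G h k = if i = k then 1 else 0)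
    (hG : ∀ i j, G i j = G j i)
    (hGis : ∀ i j, Gi i j = Gi j i) (hR : ∀ i j k, R i j k = -R i k j)
    {ric ric₀ : Fin n → Fin n → ℝ}
    (hric : ∀ h j, ric h j = ric₀ h j + (2 - (n : ℝ)) * B h j - G h j * ∑ a, ∑ b, Gi a b * B a b
      + v h * ∑ k, R k j k - ∑ k, (∑ p, Gi k p * v p) * ∑ s, G h s * R s j k) :
    ∑ h, ∑ j, Gi h j * ric h j = ∑ h, ∑ j, Gi h j * ric₀ h j
      + (2 - 2 * (n : ℝ)) * ∑ a, ∑ b, Gi a b * B a b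
      + 2 * ∑ k, (∑ p, Gi k p * v p) * ∑ s, R s k s := by
  have e (h j : Fin n) : Gi h j * ric h j = Gi h j * ric₀ h j + (2 - (n : ℝ)) * (Gi h j * B h j)
      - (∑ a, ∑ b, Gi a b * B a b) * (Gi h j * G j h) + Gi h j * (v h * ∑ k, R k j k)
      - Gi h j * ∑ k, (∑ p, Gi k p * v p) * ∑ s, G h s * R s j k := by
    rw [hric, hG h j]; ring
  have h1 : ∑ h, ∑ j, Gi h j * G j h = n := by
    simp [hGi]
  have h2 : ∑ h, ∑ j, Gi h j * (v h * ∑ k, R k j k) =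
      ∑ k, (∑ p, Gi k p * v p) * ∑ s, R s k s := by
    rw [Finset.sum_comm]
    refine Finset.sum_congr rfl fun j _ => ?_
    rw [Finset.sum_mul]
    exact Finset.sum_congr rfl fun h _ => by rw [hGis]; ring
  have h3 : ∑ h, ∑ j, Gi h j * ∑ k, (∑ p, Gi k p * v p) * ∑ s, G h s * R s j k =
      -∑ k, (∑ p, Gi k p * v p) * ∑ s, R s k s := by
    have e2 (j k : Fin n) : ∑ h, Gi h j * ∑ s, G h s * R s j k = R j j k := by
      simp only [Finset.mul_sum, ← mul_assoc]
      rw [Finset.sum_comm]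
      simp only [← Finset.sum_mul, hGis _ j, hGi, ite_mul, one_mul, zero_mul, Finset.sum_ite_eq,
        Finset.mem_univ, if_true]
    have swap (u : Fin n → ℝ) (T : Fin n → Fin n → Fin n → ℝ) :
        ∑ h, ∑ j, Gi h j * ∑ k, u k * T h j k = ∑ j, ∑ k, u k * ∑ h, Gi h j * T h j k := by
      simp only [Finset.mul_sum]
      rw [Finset.sum_comm]
      refine Finset.sum_congr rfl fun j _ => ?_
      rw [Finset.sum_comm]
      exact Finset.sum_congr rfl fun k _ => Finset.sum_congr rfl fun h _ => by ring
    calc _ = ∑ j, ∑ k, (∑ p, Gi k p * v p) * ∑ h, Gi h j * ∑ s, G h s * R s j k := by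
            exact swap _ fun h j k => ∑ s, G h s * R s j k
      _ = _ := by
            simp only [e2]
            rw [Finset.sum_comm, ← Finset.sum_neg_distrib]
            refine Finset.sum_congr rfl fun k _ => ?_
            rw [← Finset.mul_sum, ← mul_neg, ← Finset.sum_neg_distrib]
            exact congrArg _ (Finset.sum_congr rfl fun s _ => hR _ _ _)
  simp only [e, Finset.sum_sub_distrib, Finset.sum_add_distrib, h2, h3, ← Finset.mul_sum, h1]
  ring

end Contraction

/-! ### The two families of derivations: `δ/δx^i` and `∂/∂y^a` -/

section Frames

variable {V : Set (Coord n × Coord n)} {γ : Coord n → Matrix (Fin n) (Fin n) ℝ} {σ : Fn n}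
  {x y : Coord n}

theorem dy_of_x (φ : Coord n → ℝ) (k : Fin n) (x y : Coord n) :
    dy k (fun x _ => φ x) x y = 0 := by
  simp [dy, pd]

theorem delta_of_x (φ : Coord n → ℝ) (k : Fin n) (x y : Coord n) :
    delta γ k (fun x _ => φ x) x y = pd k φ x := by
  simp [delta, dy_of_x, dx]

theorem dy_liouville (i k : Fin n) (x y : Coord n) :
    dy k (liouville i) x y = if i = k then 1 else 0 := by
  have h : HasFDerivAt (fun y : Coord n => y i) (EuclideanSpace.proj i : Coord n →L[ℝ] ℝ) y :=
    (EuclideanSpace.proj i : Coord n →L[ℝ] ℝ).hasFDerivAt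
  change fderiv ℝ (fun y : Coord n => y i) y (EuclideanSpace.single k 1) = _
  rw [h.fderiv]
  simp

theorem dx_liouville (i k : Fin n) (x y : Coord n) : dx k (liouville i) x y = 0 := by
  simp [dx, pd, liouville]

theorem delta_liouville (i k : Fin n) (x y : Coord n) :
    delta γ k (liouville i) x y = -N γ i k x y := by
  simp [delta, dx_liouville, dy_liouville]

/-- On functions of `x` alone `δ/δx^i` is `∂/∂x^i`, so `γ` has its Christoffel symbols as
coefficients. -/
theorem conn_delta (i j k : Fin n) :
    conn (delta γ) (fun x _ => γ x) i j k = fun x _ => christoffel γ i j k x := by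
  funext x y
  simp only [conn, christoffel, delta_of_x]

theorem conn_dy (i j k : Fin n) : conn dy (fun x _ => γ x) i j k = fun _ _ => 0 := by
  funext x y
  simp only [conn, dy_of_x]
  simp

theorem curv_delta (i h j k : Fin n) (x y : Coord n) :
    curv (delta γ) (conn (delta γ) fun x _ => γ x) i h j k x y = rCurv γ i h j k x := by
  simp only [curv, rCurv, conn_delta, delta_of_x]

theorem curv_dy (i h j k : Fin n) (x y : Coord n) :
    curv dy (conn dy fun x _ => γ x) i h j k x y = 0 := by
  simp [curv, conn_dy, dy_of_x]

namespace IsMetric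

/-- `IsMetric V dx fun x _ => γ x` is the standing hypothesis on the chart components of `γ`; with
`∂/∂x^i` as the derivations, `conn` is the Christoffel symbol by definition. -/
theorem smooth_christoffel (h₀ : IsMetric V dx fun x _ => γ x) (i j k : Fin n) :
    IsSmooth V (fun x _ => christoffel γ i j k x) :=
  h₀.smooth_conn i j k

theorem christoffel_symm (h₀ : IsMetric V dx fun x _ => γ x) (i j k : Fin n) (x : Coord n) :
    christoffel γ i j k x = christoffel γ i k j x :=
  congrFun (congrFun (h₀.conn_symm i j k) x) 0

theorem smooth_N (h₀ : IsMetric V dx fun x _ => γ x) (i j : Fin n) : IsSmooth V (N γ i j) :=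
  IsSmooth.sum fun k _ => (h₀.smooth_christoffel i j k).mul (.liouville k)

theorem isDerivation_delta (h₀ : IsMetric V dx fun x _ => γ x) (k : Fin n) :
    IsDerivation V (delta γ k) := by
  refine ⟨fun p => (EuclideanSpace.single k 1,
    -∑ j, N γ j k p.1 p.2 • (EuclideanSpace.single j (1 : ℝ) : Coord n)), ?_, ?_⟩
  · exact contDiffOn_const.prodMk (ContDiffOn.neg (ContDiffOn.sum fun j _ =>
      ContDiffOn.smul (h₀.smooth_N j k) contDiffOn_const))
  · intro f hf x y hp
    have e (w : Coord n) : ((EuclideanSpace.single k 1 : Coord n), -w) =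
        ((EuclideanSpace.single k 1 : Coord n), (0 : Coord n)) -
          ContinuousLinearMap.inr ℝ (Coord n) (Coord n) w := by
      simp
    dsimp only
    rw [delta, dx_eq_fderiv h₀.isOpen hf k hp, e, map_sub, map_sum, map_sum]
    congr 1
    refine Finset.sum_congr rfl fun j _ => ?_
    rw [dy_eq_fderiv h₀.isOpen hf j hp, map_smul, map_smul]
    rfl

theorem delta (h₀ : IsMetric V dx fun x _ => γ x) : IsMetric V (delta γ) fun x _ => γ x :=
  { h₀ with der := h₀.isDerivation_delta }

theorem dy (h₀ : IsMetric V dx fun x _ => γ x) : IsMetric V dy fun x _ => γ x :=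
  { h₀ with der := isDerivation_dy h₀.isOpen }

theorem delta_N (h₀ : IsMetric V dx fun x _ => γ x) (hp : (x, y) ∈ V) (i j k : Fin n) :
    GenLagrange.delta γ k (N γ i j) x y = ∑ q, (pd k (christoffel γ i j q) x
      - ∑ s, christoffel γ i j s x * christoffel γ s k q x) * y q := by
  have h1 : GenLagrange.delta γ k (N γ i j) x y =
      ∑ q, (pd k (christoffel γ i j q) x * y q - christoffel γ i j q x * N γ q k x y) := by
    refine ((h₀.isDerivation_delta k).sum h₀.isOpen (F := fun q x y =>
      christoffel γ i j q x * liouville q x y)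
      (fun q _ => (h₀.smooth_christoffel i j q).mul (.liouville q)) hp).trans ?_
    refine Finset.sum_congr rfl fun q _ => ?_
    rw [(h₀.isDerivation_delta k).mul h₀.isOpen (h₀.smooth_christoffel i j q) (.liouville q) hp,
      delta_of_x, delta_liouville, liouville]
    ring
  rw [h1]
  simp only [sub_mul, Finset.sum_sub_distrib, N, Finset.sum_mul, Finset.mul_sum]
  congr 1
  rw [Finset.sum_comm]
  simp only [mul_assoc]

/-- The curvature of the nonlinear connection is `r^i_qjk y^q`. -/
theorem curvN_eq (h₀ : IsMetric V dx fun x _ => γ x) (hp : (x, y) ∈ V) (i j k : Fin n) :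
    curvN γ i j k x y = ∑ q, rCurv γ i q j k x * y q := by
  rw [curvN, h₀.delta_N hp, h₀.delta_N hp, ← Finset.sum_sub_distrib]
  refine Finset.sum_congr rfl fun q _ => ?_
  have e (j : Fin n) : christoffel γ i j q = christoffel γ i q j :=
    funext (h₀.christoffel_symm i j q)
  have e2 (j k : Fin n) : ∑ s, christoffel γ i j s x * christoffel γ s k q x =
      ∑ s, christoffel γ s q k x * christoffel γ i s j x :=
    Finset.sum_congr rfl fun s _ => by
      rw [h₀.christoffel_symm i j s, h₀.christoffel_symm s k q, mul_comm]
  rw [rCurv, e, e, e2, e2, Finset.sum_sub_distrib]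
  ring

theorem dy_N (h₀ : IsMetric V dx fun x _ => γ x) (hp : (x, y) ∈ V) (i j k : Fin n) :
    GenLagrange.dy k (N γ i j) x y = christoffel γ i j k x := by
  refine ((isDerivation_dy h₀.isOpen k).sum h₀.isOpen (F := fun q x y =>
    christoffel γ i j q x * liouville q x y)
    (fun q _ => (h₀.smooth_christoffel i j q).mul (.liouville q)) hp).trans ?_
  have e (q : Fin n) : GenLagrange.dy k (fun x y => christoffel γ i j q x * liouville q x y) x y =
      if q = k then christoffel γ i j q x else 0 := by
    rw [(isDerivation_dy h₀.isOpen k).mul h₀.isOpen (h₀.smooth_christoffel i j q) (.liouville q)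
      hp, dy_of_x, dy_liouville]
    simp
  simp [e]

/-- Expansion of `E (δσ/δx^j)` for a derivation `E`. -/
theorem der_delta (h₀ : IsMetric V dx fun x _ => γ x) (hσ : IsSmooth V σ)
    {E : Fn n → Fn n} (hE : IsDerivation V E) (hp : (x, y) ∈ V) (j : Fin n) :
    E (GenLagrange.delta γ j σ) x y = E (dx j σ) x y - ∑ m, (E (N γ m j) x y *
      GenLagrange.dy m σ x y + N γ m j x y * E (GenLagrange.dy m σ) x y) := by
  have hV := h₀.isOpen
  have hdy (m : Fin n) : IsSmooth V (GenLagrange.dy m σ) := (isDerivation_dy hV m).smooth hV hσ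
  have hs (m : Fin n) := (h₀.smooth_N m j).mul (hdy m)
  refine (hE.sub hV ((isDerivation_dx hV j).smooth hV hσ) (IsSmooth.sum fun m _ => hs m)
    hp).trans ?_
  rw [hE.sum hV (fun m _ => hs m) hp]
  exact congrArg _ (Finset.sum_congr rfl fun m _ => hE.mul hV (h₀.smooth_N m j) (hdy m) hp)

/-- The commutator of the operators `δ/δx^i` is vertical. -/
theorem delta_comm (h₀ : IsMetric V dx fun x _ => γ x) (hσ : IsSmooth V σ) (hp : (x, y) ∈ V)
    (j k : Fin n) :
    GenLagrange.delta γ k (GenLagrange.delta γ j σ) x y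
      - GenLagrange.delta γ j (GenLagrange.delta γ k σ) x y =
      -∑ m, curvN γ m j k x y * GenLagrange.dy m σ x y := by
  have hV := h₀.isOpen
  have e (a b : Fin n) : ∑ m, N γ m a x y * GenLagrange.delta γ b (GenLagrange.dy m σ) x y =
      ∑ m, N γ m a x y * GenLagrange.dy m (dx b σ) x y
      - ∑ m, ∑ s, N γ m a x y * (N γ s b x y
        * GenLagrange.dy s (GenLagrange.dy m σ) x y) := by
    rw [← Finset.sum_sub_distrib]
    refine Finset.sum_congr rfl fun m _ => ?_
    rw [GenLagrange.delta, mul_sub, Finset.mul_sum, dx_dy_comm hV hσ b m hp]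
  have e2 : ∑ m, ∑ s, N γ m k x y * (N γ s j x y
        * GenLagrange.dy s (GenLagrange.dy m σ) x y) =
      ∑ m, ∑ s, N γ m j x y * (N γ s k x y * GenLagrange.dy s (GenLagrange.dy m σ) x y) := by
    rw [Finset.sum_comm]
    refine Finset.sum_congr rfl fun m _ => Finset.sum_congr rfl fun s _ => ?_
    rw [dy_dy_comm hV hσ m s hp]
    ring
  rw [h₀.der_delta hσ (h₀.isDerivation_delta k) hp, h₀.der_delta hσ (h₀.isDerivation_delta j) hp,
    Finset.sum_add_distrib, Finset.sum_add_distrib, e, e, e2]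
  have e3 (a b : Fin n) : GenLagrange.delta γ b (dx a σ) x y = dx b (dx a σ) x y
      - ∑ s, N γ s b x y * GenLagrange.dy s (dx a σ) x y := rfl
  have e4 : ∑ m, curvN γ m j k x y * GenLagrange.dy m σ x y =
      ∑ m, GenLagrange.delta γ k (N γ m j) x y * GenLagrange.dy m σ x y
      - ∑ m, GenLagrange.delta γ j (N γ m k) x y * GenLagrange.dy m σ x y := by
    rw [← Finset.sum_sub_distrib]
    exact Finset.sum_congr rfl fun m _ => sub_mul _ _ _
  rw [e3, e3, e4, dx_dx_comm hV hσ j k hp]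
  ring

/-- The commutator `[∂/∂y^k, δ/δx^j]` is `-Γ^m_jk ∂/∂y^m`, as `∂N^m_j/∂y^k = Γ^m_jk`. -/
theorem dy_delta_comm (h₀ : IsMetric V dx fun x _ => γ x) (hσ : IsSmooth V σ) (hp : (x, y) ∈ V)
    (j k : Fin n) :
    GenLagrange.dy k (GenLagrange.delta γ j σ) x y
      - GenLagrange.delta γ j (GenLagrange.dy k σ) x y =
      -∑ m, christoffel γ m j k x * GenLagrange.dy m σ x y := by
  have hV := h₀.isOpen
  rw [h₀.der_delta hσ (isDerivation_dy hV k) hp, GenLagrange.delta, dx_dy_comm hV hσ j k hp,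
    Finset.sum_add_distrib]
  have e : ∑ m, N γ m j x y * GenLagrange.dy k (GenLagrange.dy m σ) x y =
      ∑ m, N γ m j x y * GenLagrange.dy m (GenLagrange.dy k σ) x y :=
    Finset.sum_congr rfl fun m _ => by rw [dy_dy_comm hV hσ k m hp]
  simp only [e, h₀.dy_N hp]
  ring

end IsMetric

end Frames

/-! ### The Einstein equations -/

section Einstein

variable {V : Set (Coord n × Coord n)} {γ : Coord n → Matrix (Fin n) (Fin n) ℝ} {σ : Fn n}
  {x y : Coord n}

/-- The conformal factor cancels in `g^ij T_ij g_ab`. -/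
theorem sum_exp_smul_inv_mul {A : Matrix (Fin n) (Fin n) ℝ} (hA : A.det ≠ 0) (c : ℝ)
    (T : Fin n → Fin n → ℝ) (a b : Fin n) :
    (∑ i, ∑ j, (Real.exp c • A)⁻¹ i j * T i j) * (Real.exp c • A) a b =
      (∑ i, ∑ j, A⁻¹ i j * T i j) * A a b := by
  have he : Real.exp c ≠ 0 := (Real.exp_pos _).ne'
  rw [inv_exp_smul hA]
  simp only [Matrix.smul_apply, smul_eq_mul, mul_assoc, ← Finset.mul_sum]
  field_simp

namespace IsMetric

/-- `σ_ij` and `σ̇_ab`, which are written with the conformally changed connection, in terms of the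
connection of `G`. -/
theorem schoutenChange_eq {D : Fin n → Fn n → Fn n}
    {G : Coord n → Coord n → Matrix (Fin n) (Fin n) ℝ} (hM : IsMetric V D G)
    (hσ : IsSmooth V σ) (hp : (x, y) ∈ V) (i j : Fin n) :
    D j (D i σ) x y
      - ∑ m, conn D (fun x y => Real.exp (2 * σ x y) • G x y) m i j x y * D m σ x y
      + D i σ x y * D j σ x y
      - G x y i j * (∑ k, ∑ l, (G x y)⁻¹ k l * D k σ x y * D l σ x y) / 2 =
    schoutenChange D G σ i j x y := by
  have h1 : ∑ k, ∑ l, (G x y)⁻¹ k l * D k σ x y * D l σ x y =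
      ∑ m, grad D G σ m x y * D m σ x y := by
    simp only [grad, Finset.sum_mul]
    exact Finset.sum_congr rfl fun k _ => Finset.sum_congr rfl fun l _ => by ring
  have e (m : Fin n) : conn D (fun x y => Real.exp (2 * σ x y) • G x y) m i j x y * D m σ x y =
      conn D G m i j x y * D m σ x y + (if m = j then D i σ x y * D m σ x y else 0)
      + (if m = i then D j σ x y * D m σ x y else 0)
      - G x y i j * (grad D G σ m x y * D m σ x y) := by
    rw [hM.conn_conformal hσ hp]
    split_ifs <;> ring
  simp only [e, h1, Finset.sum_sub_distrib, Finset.sum_add_distrib, Finset.sum_ite_eq',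
    Finset.mem_univ, if_true, ← Finset.mul_sum, schoutenChange]
  ring

theorem sh2_eq (h₀ : IsMetric V dx fun x _ => γ x) (hσ : IsSmooth V σ) (hp : (x, y) ∈ V)
    (i j : Fin n) :
    sh2 γ σ i j x y = schoutenChange (GenLagrange.delta γ) (fun x _ => γ x) σ i j x y :=
  h₀.delta.schoutenChange_eq hσ hp i j

theorem sv2_eq (h₀ : IsMetric V dx fun x _ => γ x) (hσ : IsSmooth V σ) (hp : (x, y) ∈ V)
    (a b : Fin n) :
    sv2 γ σ a b x y = schoutenChange GenLagrange.dy (fun x _ => γ x) σ a b x y :=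
  h₀.dy.schoutenChange_eq hσ hp a b

theorem C_eq (h₀ : IsMetric V dx fun x _ => γ x) (hσ : IsSmooth V σ) (hp : (x, y) ∈ V)
    (i j k : Fin n) :
    C γ σ i j k x y = (if i = k then 1 else 0) * sv σ j x y + (if i = j then 1 else 0) * sv σ k x y
      - γ x j k * ∑ p, (γ x)⁻¹ i p * sv σ p x y := by
  refine (h₀.dy.conn_conformal hσ hp i j k).trans ?_
  rw [conn_dy, zero_add]
  rfl

/-- The term `C^i_hs R^s_jk` of the `h`-curvature cancels the contribution of the commutator
`[δ/δx^k, δ/δx^j]σ`. -/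
theorem hCurv_eq (h₀ : IsMetric V dx fun x _ => γ x) (hσ : IsSmooth V σ) (hp : (x, y) ∈ V)
    (i h j k : Fin n) :
    hCurv γ σ i h j k x y = rCurv γ i h j k x
      + (if i = j then 1 else 0) * sh2 γ σ h k x y - (if i = k then 1 else 0) * sh2 γ σ h j x y
      - γ x h j * ∑ a, (γ x)⁻¹ i a * sh2 γ σ a k x y
      + γ x h k * ∑ a, (γ x)⁻¹ i a * sh2 γ σ a j x y
      + sv σ h x y * curvN γ i j k x y
      - (∑ p, (γ x)⁻¹ i p * sv σ p x y) * ∑ s, γ x h s * curvN γ s j k x y := by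
  have h1 := h₀.delta.curv_conformal hσ hp i h j k
  rw [curv_delta, h₀.delta_comm hσ hp] at h1
  simp only [← h₀.sh2_eq hσ hp] at h1
  have h2 : ∑ s, C γ σ i h s x y * curvN γ s j k x y =
      sv σ h x y * curvN γ i j k x y
      + (if i = h then 1 else 0) * ∑ m, curvN γ m j k x y * GenLagrange.dy m σ x y
      - (∑ p, (γ x)⁻¹ i p * sv σ p x y) * ∑ s, γ x h s * curvN γ s j k x y := by
    have e (s : Fin n) : C γ σ i h s x y * curvN γ s j k x y =
        (if i = s then sv σ h x y * curvN γ s j k x y else 0)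
        + (if i = h then 1 else 0) * (curvN γ s j k x y * GenLagrange.dy s σ x y)
        - (∑ p, (γ x)⁻¹ i p * sv σ p x y) * (γ x h s * curvN γ s j k x y) := by
      rw [h₀.C_eq hσ hp, sv, sv]
      split_ifs <;> ring
    simp only [e, Finset.sum_sub_distrib, Finset.sum_add_distrib, Finset.sum_ite_eq,
      Finset.mem_univ, if_true, ← Finset.mul_sum]
  have h3 : hCurv γ σ i h j k x y =
      curv (GenLagrange.delta γ) (conn (GenLagrange.delta γ)
        fun x y => Real.exp (2 * σ x y) • γ x) i h j k x y
      + ∑ s, C γ σ i h s x y * curvN γ s j k x y := rfl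
  rw [h3, h1, h2]
  ring

theorem vCurv_eq (h₀ : IsMetric V dx fun x _ => γ x) (hσ : IsSmooth V σ) (hp : (x, y) ∈ V)
    (i h j k : Fin n) :
    vCurv γ σ i h j k x y = (if i = j then 1 else 0) * sv2 γ σ h k x y
      - (if i = k then 1 else 0) * sv2 γ σ h j x y
      - γ x h j * ∑ a, (γ x)⁻¹ i a * sv2 γ σ a k x y
      + γ x h k * ∑ a, (γ x)⁻¹ i a * sv2 γ σ a j x y := by
  have h1 := h₀.dy.curv_conformal hσ hp i h j k
  rw [curv_dy, dy_dy_comm h₀.isOpen hσ k j hp] at h1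
  simp only [← h₀.sv2_eq hσ hp] at h1
  have h3 : vCurv γ σ i h j k x y = curv GenLagrange.dy (conn GenLagrange.dy
        fun x y => Real.exp (2 * σ x y) • γ x) i h j k x y := rfl
  rw [h3, h1]
  ring

theorem hRic_eq (h₀ : IsMetric V dx fun x _ => γ x) (hσ : IsSmooth V σ) (hp : (x, y) ∈ V)
    (h j : Fin n) :
    hRic γ σ h j x y = rRic γ h j x + (2 - (n : ℝ)) * sh2 γ σ h j x y
      - γ x h j * sigmaBar γ σ x y + sv σ h x y * ∑ k, curvN γ k j k x y
      - ∑ k, (∑ p, (γ x)⁻¹ k p * sv σ p x y) * ∑ s, γ x h s * curvN γ s j k x y :=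
  ricci_conformal_algebra (G := γ x) (Gi := (γ x)⁻¹) (B := fun i j => sh2 γ σ i j x y)
    (R := fun i j k => curvN γ i j k x y) (v := fun i => sv σ i x y)
    (K := fun i h j k => hCurv γ σ i h j k x y) (ρ := fun i h j k => rCurv γ i h j k x)
    (h₀.sum_inv_mul hp) (h₀.symm x y) (h₀.inv_symm x y) (h₀.hCurv_eq hσ hp) h j

theorem vRic_eq (h₀ : IsMetric V dx fun x _ => γ x) (hσ : IsSmooth V σ) (hp : (x, y) ∈ V)
    (a b : Fin n) :
    vRic γ σ a b x y = (2 - (n : ℝ)) * sv2 γ σ a b x y - γ x a b * sigmaDot γ σ x y := by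
  have := ricci_conformal_algebra (G := γ x) (Gi := (γ x)⁻¹) (B := fun a b => sv2 γ σ a b x y)
    (R := fun _ _ _ => 0) (v := fun _ => 0) (K := fun i h j k => vCurv γ σ i h j k x y)
    (ρ := fun _ _ _ _ => 0) (h₀.sum_inv_mul hp) (h₀.symm x y) (h₀.inv_symm x y)
    (fun i h j k => by rw [h₀.vCurv_eq hσ hp]; simp) a b
  simpa [vRic, sigmaDot] using this

theorem einstein_h (h₀ : IsMetric V dx fun x _ => γ x) (hσ : IsSmooth V σ) (hp : (x, y) ∈ V)
    (i j : Fin n) :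
    hRic γ σ i j x y - (1 / 2) * hScal γ σ x y * g γ σ x y i j =
      rRic γ i j x - (1 / 2) * rScal γ x * γ x i j + corr γ σ i j x y := by
  have hsc : hScal γ σ x y * g γ σ x y i j = (∑ a, ∑ b, (γ x)⁻¹ a b * hRic γ σ a b x y) * γ x i j :=
    sum_exp_smul_inv_mul (h₀.det x y hp) _ _ _ _
  have htr := scalar_conformal_algebra (G := γ x) (Gi := (γ x)⁻¹) (h₀.sum_inv_mul hp)
    (h₀.symm x y) (h₀.inv_symm x y) (B := fun i j => sh2 γ σ i j x y)
    (R := fun i j k => curvN γ i j k x y) (v := fun i => sv σ i x y)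
    (ric := fun i j => hRic γ σ i j x y) (ric₀ := fun i j => rRic γ i j x)
    (fun i j k => by simp only [curvN]; ring) (h₀.hRic_eq hσ hp)
  -- `R^k_jk` is written both as `r_sj y^s` and as `r^a_tja y^t`, the two forms in `t_ij`.
  have hq (j : Fin n) : ∑ k, curvN γ k j k x y = ∑ s, rRic γ s j x * y s := by
    simp only [h₀.curvN_eq hp, rRic, Finset.sum_mul]
    exact Finset.sum_comm
  have hq' (j : Fin n) : ∑ k, curvN γ k j k x y = ∑ a, ∑ t, rCurv γ a t j a x * y t := by
    simp only [h₀.curvN_eq hp]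
  have h1 : ∑ s, ∑ t, ∑ p, rRic γ s t x * y s * (γ x)⁻¹ t p * sv σ p x y =
      ∑ k, (∑ p, (γ x)⁻¹ k p * sv σ p x y) * ∑ s, curvN γ s k s x y := by
    simp only [hq]
    rw [Finset.sum_comm]
    refine Finset.sum_congr rfl fun t _ => ?_
    rw [Finset.mul_sum]
    refine Finset.sum_congr rfl fun s _ => ?_
    rw [Finset.sum_mul]
    exact Finset.sum_congr rfl fun p _ => by ring
  have h2 : ∑ s, ∑ a, ∑ p, ∑ t, γ x i s * (γ x)⁻¹ a p * sv σ p x y * rCurv γ s t j a x * y t =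
      ∑ k, (∑ p, (γ x)⁻¹ k p * sv σ p x y) * ∑ s, γ x i s * curvN γ s j k x y := by
    simp only [h₀.curvN_eq hp]
    rw [Finset.sum_comm]
    refine Finset.sum_congr rfl fun a _ => ?_
    rw [Finset.mul_sum]
    refine Finset.sum_congr rfl fun s _ => ?_
    rw [Finset.sum_mul]
    refine Finset.sum_congr rfl fun p _ => ?_
    rw [Finset.mul_sum, Finset.mul_sum]
    exact Finset.sum_congr rfl fun t _ => by ring
  rw [mul_assoc, hsc, htr, h₀.hRic_eq hσ hp, corr, h1, h2, ← hq', rScal, sigmaBar]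
  ring

theorem einstein_v (h₀ : IsMetric V dx fun x _ => γ x) (hσ : IsSmooth V σ) (hp : (x, y) ∈ V)
    (a b : Fin n) :
    vRic γ σ a b x y - (1 / 2) * vScal γ σ x y * g γ σ x y a b =
      (2 - (n : ℝ)) * (sv2 γ σ a b x y - sigmaDot γ σ x y * γ x a b) := by
  have hsc : vScal γ σ x y * g γ σ x y a b = (∑ a, ∑ b, (γ x)⁻¹ a b * vRic γ σ a b x y) * γ x a b :=
    sum_exp_smul_inv_mul (h₀.det x y hp) _ _ _ _
  have htr := scalar_conformal_algebra (G := γ x) (Gi := (γ x)⁻¹)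
    (B := fun a b => sv2 γ σ a b x y) (R := fun _ _ _ => 0) (v := fun _ => 0)
    (ric := fun a b => vRic γ σ a b x y) (ric₀ := fun _ _ => 0) (h₀.sum_inv_mul hp)
    (h₀.symm x y) (h₀.inv_symm x y) (fun _ _ _ => by simp)
    (fun a b => by rw [h₀.vRic_eq hσ hp, sigmaDot]; simp)
  simp only [mul_zero, Finset.sum_const_zero, zero_add, add_zero] at htr
  rw [mul_assoc, hsc, htr, h₀.vRic_eq hσ hp, sigmaDot]
  ring

end IsMetric

end Einstein

/-! ### The Maxwell equations -/

section Maxwell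

variable {V : Set (Coord n × Coord n)} {γ : Coord n → Matrix (Fin n) (Fin n) ℝ} {σ : Fn n}
  {x y : Coord n}

/-- The covariant Liouville field `Y_i = G_ip y^p`. -/
noncomputable def lowerLiouville (G : Coord n → Coord n → Matrix (Fin n) (Fin n) ℝ) (i : Fin n) :
    Fn n := fun x y => ∑ p, G x y i p * y p

theorem lowerLiouville_exp_smul (σ : Fn n) (G : Coord n → Coord n → Matrix (Fin n) (Fin n) ℝ)
    (k : Fin n) : lowerLiouville (fun x y => Real.exp (2 * σ x y) • G x y) k =
      fun x y => Real.exp (2 * σ x y) * lowerLiouville G k x y := by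
  funext x y
  simp only [lowerLiouville, Matrix.smul_apply, smul_eq_mul, mul_assoc, Finset.mul_sum]

theorem sum_eq_lowerLiouville (γ : Coord n → Matrix (Fin n) (Fin n) ℝ) (σ : Fn n)
    (x y : Coord n) (i j : Fin n) (a b : ℝ) :
    ∑ p, (g γ σ x y i p * a - g γ σ x y j p * b) * y p =
      lowerLiouville (g γ σ) i x y * a - lowerLiouville (g γ σ) j x y * b := by
  simp only [lowerLiouville, Finset.sum_mul, ← Finset.sum_sub_distrib]
  exact Finset.sum_congr rfl fun p _ => by ring

/-- In the cyclic sum of the covariant derivatives of a skew-symmetric tensor the coefficients of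
a symmetric connection cancel. -/
theorem cyc_cov_skew (Λ T : Fin n → Fin n → Fin n → ℝ) (S : Fin n → Fin n → ℝ)
    (hΛ : ∀ i j k, Λ i j k = Λ i k j) (hS : ∀ i j, S i j = -S j i) (i j k : Fin n) :
    cyc (fun i j k => T i j k - ∑ m, Λ m i k * S m j - ∑ m, Λ m j k * S i m) i j k =
      cyc T i j k := by
  have e (a b : Fin n) (c : Fin n) : ∑ m, Λ m a b * S c m = -∑ m, Λ m b a * S m c := by
    rw [← Finset.sum_neg_distrib]
    exact Finset.sum_congr rfl fun m _ => by rw [hΛ, hS]; ring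
  simp only [cyc, e]
  ring

namespace IsMetric

theorem smooth_lowerLiouville {D : Fin n → Fn n → Fn n}
    {G : Coord n → Coord n → Matrix (Fin n) (Fin n) ℝ} (hM : IsMetric V D G) (i : Fin n) :
    IsSmooth V (lowerLiouville G i) :=
  IsSmooth.sum fun p _ => (hM.smooth i p).mul (.liouville p)

/-- If the deflection of `conn D G` is a multiple `c` of the identity, the skew part of
`D_j(e^{2σ} Y_k)` comes from the conformal factor alone: `D_j Y_k` is then `Γ^m_kj Y_m + c G_kj`,
which is symmetric. The families `δ/δx^i` and `∂/∂y^a` have `c = 0` and `c = 1`. -/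
theorem der_lowerLiouville {D : Fin n → Fn n → Fn n}
    {G : Coord n → Coord n → Matrix (Fin n) (Fin n) ℝ} (hM : IsMetric V D G)
    (hσ : IsSmooth V σ) (hp : (x, y) ∈ V) {c : ℝ}
    (hc : ∀ m j, D j (liouville m) x y + ∑ p, conn D G m p j x y * y p =
      c * if m = j then 1 else 0) (j k : Fin n) :
    D j (lowerLiouville (fun x y => Real.exp (2 * σ x y) • G x y) k) x y
      - D k (lowerLiouville (fun x y => Real.exp (2 * σ x y) • G x y) j) x y =
    2 * (D j σ x y * lowerLiouville (fun x y => Real.exp (2 * σ x y) • G x y) k x y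
      - D k σ x y * lowerLiouville (fun x y => Real.exp (2 * σ x y) • G x y) j x y) := by
  have h2 : IsSmooth V (fun x y => 2 * σ x y) := (IsSmooth.const 2).mul hσ
  have h1 (j k : Fin n) : D j (lowerLiouville G k) x y =
      ∑ m, conn D G m k j x y * lowerLiouville G m x y + c * G x y k j := by
    have e : D j (lowerLiouville G k) x y = ∑ p, (D j (fun x y => G x y k p) x y * y p
        + G x y k p * D j (liouville p) x y) := by
      refine ((hM.der j).sum hM.isOpen (F := fun p x y => G x y k p * liouville p x y)
        (fun p _ => (hM.smooth k p).mul (.liouville p)) hp).trans ?_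
      exact Finset.sum_congr rfl fun p _ =>
        (hM.der j).mul hM.isOpen (hM.smooth k p) (.liouville p) hp
    have e1 : ∑ p, (∑ m, conn D G m k j x y * G x y m p) * y p =
        ∑ m, conn D G m k j x y * lowerLiouville G m x y := by
      simp only [Finset.sum_mul, lowerLiouville, Finset.mul_sum]
      rw [Finset.sum_comm]
      simp only [mul_assoc]
    have e2 : ∑ p, (∑ m, conn D G m p j x y * G x y k m) * y p =
        ∑ m, G x y k m * ∑ p, conn D G m p j x y * y p := by
      simp only [Finset.sum_mul, Finset.mul_sum]
      rw [Finset.sum_comm]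
      exact Finset.sum_congr rfl fun m _ => Finset.sum_congr rfl fun p _ => by ring
    have e3 : ∑ m, G x y k m * D j (liouville m) x y +
        ∑ m, G x y k m * ∑ p, conn D G m p j x y * y p = c * G x y k j := by
      rw [← Finset.sum_add_distrib]
      simp only [← mul_add, hc, mul_ite, mul_one, mul_zero, Finset.sum_ite_eq', Finset.mem_univ,
        if_true]
      ring
    rw [e]
    simp only [hM.metrical hp, add_mul, Finset.sum_add_distrib, e1, e2]
    linear_combination e3
  have h3 : ∑ m, conn D G m k j x y * lowerLiouville G m x y =
      ∑ m, conn D G m j k x y * lowerLiouville G m x y :=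
    Finset.sum_congr rfl fun m _ => by rw [hM.conn_symm]
  rw [lowerLiouville_exp_smul, lowerLiouville_exp_smul,
    (hM.der j).mul hM.isOpen h2.exp (hM.smooth_lowerLiouville k) hp,
    (hM.der k).mul hM.isOpen h2.exp (hM.smooth_lowerLiouville j) hp,
    (hM.der j).exp hM.isOpen h2 hp, (hM.der k).exp hM.isOpen h2 hp,
    (hM.der j).const_mul hM.isOpen 2 hσ hp, (hM.der k).const_mul hM.isOpen 2 hσ hp, h1, h1, h3,
    hM.symm x y k j]
  ring

/-- The skew-symmetric part of the deflection tensor of the conformally changed connection. -/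
theorem skew_deflection {D : Fin n → Fn n → Fn n}
    {G : Coord n → Coord n → Matrix (Fin n) (Fin n) ℝ} (hM : IsMetric V D G)
    (hσ : IsSmooth V σ) (hp : (x, y) ∈ V) {c : ℝ}
    (hc : ∀ m j, D j (liouville m) x y + ∑ p, conn D G m p j x y * y p =
      c * if m = j then 1 else 0) (i j : Fin n) :
    (1 / 2) * (∑ m, (Real.exp (2 * σ x y) • G x y) i m * (D j (liouville m) x y
        + ∑ p, conn D (fun x y => Real.exp (2 * σ x y) • G x y) m p j x y * liouville p x y)
      - ∑ m, (Real.exp (2 * σ x y) • G x y) j m * (D i (liouville m) x y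
        + ∑ p, conn D (fun x y => Real.exp (2 * σ x y) • G x y) m p i x y * liouville p x y)) =
    lowerLiouville (fun x y => Real.exp (2 * σ x y) • G x y) i x y * D j σ x y
      - lowerLiouville (fun x y => Real.exp (2 * σ x y) • G x y) j x y * D i σ x y := by
  have h1 (m j : Fin n) : D j (liouville m) x y
      + ∑ p, conn D (fun x y => Real.exp (2 * σ x y) • G x y) m p j x y * liouville p x y =
      (if m = j then c + ∑ p, D p σ x y * y p else 0) + D j σ x y * y m
        - grad D G σ m x y * lowerLiouville G j x y := by
    have e (p : Fin n) : conn D (fun x y => Real.exp (2 * σ x y) • G x y) m p j x y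
        * liouville p x y = conn D G m p j x y * y p
        + (if m = j then 1 else 0) * (D p σ x y * y p)
        + (if m = p then D j σ x y * y p else 0) - grad D G σ m x y * (G x y j p * y p) := by
      rw [hM.conn_conformal hσ hp, hM.symm x y p j, liouville]
      split_ifs <;> ring
    simp only [e, Finset.sum_sub_distrib, Finset.sum_add_distrib, Finset.sum_ite_eq,
      Finset.mem_univ, if_true, ← Finset.mul_sum]
    have := hc m j
    rw [lowerLiouville]
    split_ifs with hmj
    · rw [if_pos hmj] at this
      linear_combination this
    · rw [if_neg hmj] at this
      linear_combination this
  have h2 (i j : Fin n) : ∑ m, (Real.exp (2 * σ x y) • G x y) i m * (D j (liouville m) x y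
      + ∑ p, conn D (fun x y => Real.exp (2 * σ x y) • G x y) m p j x y * liouville p x y) =
      Real.exp (2 * σ x y) * (G x y i j * (c + ∑ p, D p σ x y * y p)
        + D j σ x y * lowerLiouville G i x y - D i σ x y * lowerLiouville G j x y) := by
    have e (m : Fin n) : Real.exp (2 * σ x y) * G x y i m *
        ((if m = j then c + ∑ p, D p σ x y * y p else 0) + D j σ x y * y m
        - grad D G σ m x y * lowerLiouville G j x y) = Real.exp (2 * σ x y) *
        ((if m = j then G x y i m * (c + ∑ p, D p σ x y * y p) else 0)
        + D j σ x y * (G x y i m * y m)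
        - lowerLiouville G j x y * (G x y i m * grad D G σ m x y)) := by
      split_ifs <;> ring
    simp only [h1, Matrix.smul_apply, smul_eq_mul, e, Finset.sum_sub_distrib,
      Finset.sum_add_distrib, Finset.sum_ite_eq', Finset.mem_univ, if_true, ← Finset.mul_sum,
      hM.sum_mul_grad hp]
    rw [lowerLiouville, lowerLiouville]
    ring
  simp only [h2, lowerLiouville_exp_smul]
  rw [hM.symm x y j i]
  ring

/-- The `h`-deflection of the connection of `γ` vanishes: this is the choice
`N^i_j = Γ^i_jk y^k`. -/
theorem deflection_delta (h₀ : IsMetric V dx fun x _ => γ x) (x y : Coord n) (m j : Fin n) :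
    GenLagrange.delta γ j (liouville m) x y
      + ∑ p, conn (GenLagrange.delta γ) (fun x _ => γ x) m p j x y * y p =
      0 * if m = j then 1 else 0 := by
  simp only [delta_liouville, conn_delta, N, h₀.christoffel_symm m _ j]
  ring

theorem deflection_dy (γ : Coord n → Matrix (Fin n) (Fin n) ℝ) (x y : Coord n) (m j : Fin n) :
    GenLagrange.dy j (liouville m) x y
      + ∑ p, conn GenLagrange.dy (fun x _ => γ x) m p j x y * y p =
      1 * if m = j then 1 else 0 := by
  simp only [dy_liouville, conn_dy]
  simp

theorem F_eq (h₀ : IsMetric V dx fun x _ => γ x) (hσ : IsSmooth V σ) (hp : (x, y) ∈ V)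
    (i j : Fin n) :
    F γ σ i j x y = lowerLiouville (g γ σ) i x y * sh γ σ j x y
      - lowerLiouville (g γ σ) j x y * sh γ σ i x y :=
  h₀.delta.skew_deflection hσ hp (h₀.deflection_delta x y) i j

theorem f_eq (h₀ : IsMetric V dx fun x _ => γ x) (hσ : IsSmooth V σ) (hp : (x, y) ∈ V)
    (i j : Fin n) :
    f γ σ i j x y = lowerLiouville (g γ σ) i x y * sv σ j x y
      - lowerLiouville (g γ σ) j x y * sv σ i x y :=
  h₀.dy.skew_deflection hσ hp (deflection_dy γ x y) i j

theorem smooth_g (h₀ : IsMetric V dx fun x _ => γ x) (hσ : IsSmooth V σ) (i j : Fin n) :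
    IsSmooth V (fun x y => g γ σ x y i j) :=
  ((IsSmooth.const 2).mul hσ).exp.mul (h₀.smooth i j)

theorem g_symm (h₀ : IsMetric V dx fun x _ => γ x) (σ : Fn n) (x y : Coord n) (i j : Fin n) :
    g γ σ x y i j = g γ σ x y j i := by
  simp only [g, Matrix.smul_apply, h₀.symm x y i j]

theorem L_symm (h₀ : IsMetric V dx fun x _ => γ x) (i j k : Fin n) :
    L γ σ i j k x y = L γ σ i k j x y :=
  congrFun₂ (conn_symm_of_symm (GenLagrange.delta γ) (G := g γ σ) (h₀.g_symm σ) i j k) x y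

theorem C_symm (h₀ : IsMetric V dx fun x _ => γ x) (i j k : Fin n) :
    C γ σ i j k x y = C γ σ i k j x y :=
  congrFun₂ (conn_symm_of_symm GenLagrange.dy (G := g γ σ) (h₀.g_symm σ) i j k) x y

/-- Derivative of `T_ij = Y_i w_j - Y_j w_i`, an identity known only on `V`. -/
theorem der_skew {E : Fn n → Fn n} (hE : IsDerivation V E) (hV : IsOpen V) {Y w : Fin n → Fn n}
    {T : Fin n → Fin n → Fn n} (hY : ∀ i, IsSmooth V (Y i)) (hw : ∀ i, IsSmooth V (w i))
    (hT : ∀ x y, (x, y) ∈ V → ∀ i j, T i j x y = Y i x y * w j x y - Y j x y * w i x y)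
    (hp : (x, y) ∈ V) (i j : Fin n) :
    E (T i j) x y = E (Y i) x y * w j x y + Y i x y * E (w j) x y
      - (E (Y j) x y * w i x y + Y j x y * E (w i) x y) := by
  rw [hE.congr hV (((hY i).mul (hw j)).sub ((hY j).mul (hw i))) (fun x y hp => hT x y hp i j) hp,
    hE.sub hV ((hY i).mul (hw j)) ((hY j).mul (hw i)) hp, hE.mul hV (hY i) (hw j) hp,
    hE.mul hV (hY j) (hw i) hp]

theorem smooth_Y (h₀ : IsMetric V dx fun x _ => γ x) (hσ : IsSmooth V σ) (i : Fin n) :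
    IsSmooth V (lowerLiouville (g γ σ) i) :=
  IsSmooth.sum fun p _ => (h₀.smooth_g hσ i p).mul (.liouville p)

theorem smooth_sh (h₀ : IsMetric V dx fun x _ => γ x) (hσ : IsSmooth V σ) (i : Fin n) :
    IsSmooth V (sh γ σ i) :=
  (h₀.isDerivation_delta i).smooth h₀.isOpen hσ

theorem smooth_sv (h₀ : IsMetric V dx fun x _ => γ x) (hσ : IsSmooth V σ) (i : Fin n) :
    IsSmooth V (sv σ i) :=
  (isDerivation_dy h₀.isOpen i).smooth h₀.isOpen hσ

theorem F_skew (γ : Coord n → Matrix (Fin n) (Fin n) ℝ) (σ : Fn n) (x y : Coord n) (i j : Fin n) :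
    F γ σ i j x y = -F γ σ j i x y := by
  simp only [F]; ring

theorem f_skew (γ : Coord n → Matrix (Fin n) (Fin n) ℝ) (σ : Fn n) (x y : Coord n) (i j : Fin n) :
    f γ σ i j x y = -f γ σ j i x y := by
  simp only [f]; ring

/-- The cyclic sum of `F_{ij|k}` is that of `Y_i [δ/δx^k, δ/δx^j]σ`. -/
theorem maxwell_hh (h₀ : IsMetric V dx fun x _ => γ x) (hσ : IsSmooth V σ) (hp : (x, y) ∈ V)
    (i j k : Fin n) :
    cyc (fun i j k => hCov2 γ σ (F γ σ) i j k x y) i j k =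
      - cyc (fun i j k => ∑ p, ∑ q, ∑ h, g γ σ x y i p *
            rCurv γ h q j k x * sv σ h x y * y p * y q) i j k := by
  have hcov := cyc_cov_skew (fun i j k => L γ σ i j k x y)
    (fun i j k => GenLagrange.delta γ k (F γ σ i j) x y) (fun i j => F γ σ i j x y)
    (fun _ _ _ => h₀.L_symm _ _ _) (F_skew γ σ x y) i j k
  refine hcov.trans ?_
  have hder (i j k : Fin n) := der_skew (h₀.isDerivation_delta k) h₀.isOpen (h₀.smooth_Y hσ)
    (h₀.smooth_sh hσ) (fun x y hp => h₀.F_eq hσ hp) hp i j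
  have hY (j k : Fin n) : GenLagrange.delta γ j (lowerLiouville (g γ σ) k) x y
      - GenLagrange.delta γ k (lowerLiouville (g γ σ) j) x y =
      2 * (sh γ σ j x y * lowerLiouville (g γ σ) k x y
        - sh γ σ k x y * lowerLiouville (g γ σ) j x y) :=
    h₀.delta.der_lowerLiouville hσ hp (h₀.deflection_delta x y) j k
  have hR (i j k : Fin n) : ∑ p, ∑ q, ∑ h, g γ σ x y i p *
      rCurv γ h q j k x * sv σ h x y * y p * y q =
      -(lowerLiouville (g γ σ) i x y * (GenLagrange.delta γ k (sh γ σ j) x y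
        - GenLagrange.delta γ j (sh γ σ k) x y)) := by
    have h1 : GenLagrange.delta γ k (sh γ σ j) x y - GenLagrange.delta γ j (sh γ σ k) x y =
        -∑ m, curvN γ m j k x y * sv σ m x y := h₀.delta_comm hσ hp j k
    rw [h1, mul_neg, neg_neg]
    simp only [lowerLiouville, Finset.sum_mul, h₀.curvN_eq hp]
    refine Finset.sum_congr rfl fun p _ => ?_
    rw [Finset.sum_comm, Finset.mul_sum]
    refine Finset.sum_congr rfl fun m _ => ?_
    rw [Finset.mul_sum]
    exact Finset.sum_congr rfl fun q _ => by ring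
  simp only [cyc, hder, hR]
  linear_combination sh γ σ i x y * hY j k + sh γ σ j x y * hY k i + sh γ σ k x y * hY i j

theorem maxwell_hv (h₀ : IsMetric V dx fun x _ => γ x) (hσ : IsSmooth V σ) (hp : (x, y) ∈ V)
    (i j k : Fin n) :
    cyc (fun i j k => vCov2 γ σ (F γ σ) i j k x y) i j k =
      - cyc (fun i j k => hCov2 γ σ (f γ σ) i j k x y) i j k := by
  have hF := cyc_cov_skew (fun i j k => C γ σ i j k x y)
    (fun i j k => GenLagrange.dy k (F γ σ i j) x y) (fun i j => F γ σ i j x y)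
    (fun _ _ _ => h₀.C_symm _ _ _) (F_skew γ σ x y) i j k
  have hf := cyc_cov_skew (fun i j k => L γ σ i j k x y)
    (fun i j k => GenLagrange.delta γ k (f γ σ i j) x y) (fun i j => f γ σ i j x y)
    (fun _ _ _ => h₀.L_symm _ _ _) (f_skew γ σ x y) i j k
  refine hF.trans ((congrArg Neg.neg hf).trans ?_).symm
  have hderF (i j k : Fin n) := der_skew (isDerivation_dy h₀.isOpen k) h₀.isOpen (h₀.smooth_Y hσ)
    (h₀.smooth_sh hσ) (fun x y hp => h₀.F_eq hσ hp) hp i j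
  have hderf (i j k : Fin n) := der_skew (h₀.isDerivation_delta k) h₀.isOpen (h₀.smooth_Y hσ)
    (h₀.smooth_sv hσ) (fun x y hp => h₀.f_eq hσ hp) hp i j
  have hYh (j k : Fin n) : GenLagrange.delta γ j (lowerLiouville (g γ σ) k) x y
      - GenLagrange.delta γ k (lowerLiouville (g γ σ) j) x y =
      2 * (sh γ σ j x y * lowerLiouville (g γ σ) k x y
        - sh γ σ k x y * lowerLiouville (g γ σ) j x y) :=
    h₀.delta.der_lowerLiouville hσ hp (h₀.deflection_delta x y) j k
  have hYv (j k : Fin n) : GenLagrange.dy j (lowerLiouville (g γ σ) k) x y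
      - GenLagrange.dy k (lowerLiouville (g γ σ) j) x y =
      2 * (sv σ j x y * lowerLiouville (g γ σ) k x y
        - sv σ k x y * lowerLiouville (g γ σ) j x y) :=
    h₀.dy.der_lowerLiouville hσ hp (deflection_dy γ x y) j k
  -- `[∂/∂y^k, δ/δx^j]σ` is symmetric in `j, k` because the Christoffel symbols are.
  have hcomm (j k : Fin n) : GenLagrange.dy k (sh γ σ j) x y - GenLagrange.delta γ j (sv σ k) x y =
      GenLagrange.dy j (sh γ σ k) x y - GenLagrange.delta γ k (sv σ j) x y := by
    refine (h₀.dy_delta_comm hσ hp j k).trans (Eq.trans ?_ (h₀.dy_delta_comm hσ hp k j).symm)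
    simp only [h₀.christoffel_symm _ j k]
  simp only [cyc, hderF, hderf]
  linear_combination -(sh γ σ i x y * hYv j k + sh γ σ j x y * hYv k i + sh γ σ k x y * hYv i j
    + sv σ i x y * hYh j k + sv σ j x y * hYh k i + sv σ k x y * hYh i j
    + lowerLiouville (g γ σ) i x y * hcomm j k + lowerLiouville (g γ σ) j x y * hcomm k i
    + lowerLiouville (g γ σ) k x y * hcomm i j)

theorem maxwell_vv (h₀ : IsMetric V dx fun x _ => γ x) (hσ : IsSmooth V σ) (hp : (x, y) ∈ V)
    (i j k : Fin n) :
    cyc (fun i j k => vCov2 γ σ (f γ σ) i j k x y) i j k = 0 := by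
  have hcov := cyc_cov_skew (fun i j k => C γ σ i j k x y)
    (fun i j k => GenLagrange.dy k (f γ σ i j) x y) (fun i j => f γ σ i j x y)
    (fun _ _ _ => h₀.C_symm _ _ _) (f_skew γ σ x y) i j k
  refine hcov.trans ?_
  have hder (i j k : Fin n) := der_skew (isDerivation_dy h₀.isOpen k) h₀.isOpen (h₀.smooth_Y hσ)
    (h₀.smooth_sv hσ) (fun x y hp => h₀.f_eq hσ hp) hp i j
  have hY (j k : Fin n) : GenLagrange.dy j (lowerLiouville (g γ σ) k) x y
      - GenLagrange.dy k (lowerLiouville (g γ σ) j) x y =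
      2 * (sv σ j x y * lowerLiouville (g γ σ) k x y
        - sv σ k x y * lowerLiouville (g γ σ) j x y) :=
    h₀.dy.der_lowerLiouville hσ hp (deflection_dy γ x y) j k
  have hcomm (j k : Fin n) : GenLagrange.dy k (sv σ j) x y = GenLagrange.dy j (sv σ k) x y :=
    dy_dy_comm h₀.isOpen hσ k j hp
  simp only [cyc, hder]
  linear_combination sv σ i x y * hY j k + sv σ j x y * hY k i + sv σ k x y * hY i j
    + lowerLiouville (g γ σ) i x y * hcomm j k + lowerLiouville (g γ σ) j x y * hcomm k i
    + lowerLiouville (g γ σ) k x y * hcomm i j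

end IsMetric

end Maxwell

end GenLagrange

theorem mainTheorem3 {n : ℕ} {M : Type*} [TopologicalSpace M]
    [ChartedSpace (GenLagrange.Coord n) M] [IsManifold (𝓡 n) ∞ M]
    (γM : Bundle.ContMDiffRiemannianMetric (𝓡 n) ∞ (GenLagrange.Coord n)
      (fun p : M => TangentSpace (𝓡 n) p))
    (U : Set (TangentBundle (𝓡 n) M)) (hU : IsOpen U)
    (σM : TangentBundle (𝓡 n) M → ℝ)
    (hσ : ContMDiffOn (𝓡 n).tangent 𝓘(ℝ, ℝ) ∞ σM U)
    (e : OpenPartialHomeomorph M (GenLagrange.Coord n))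
    (he : e ∈ IsManifold.maximalAtlas (𝓡 n) ∞ M)
    (γ : GenLagrange.Coord n → Matrix (Fin n) (Fin n) ℝ)
    (hγ : γ = GenLagrange.localMetric γM e)
    (σ : GenLagrange.Fn n) (hσe : σ = GenLagrange.localFn σM e)
    (x y : GenLagrange.Coord n) (hx : x ∈ e.target)
    (hxy : GenLagrange.tangentPoint e x y ∈ U) :
    -- the electromagnetic tensors
    (∀ i j, GenLagrange.F γ σ i j x y =
      ∑ p, (GenLagrange.g γ σ x y i p * GenLagrange.sh γ σ j x y
        - GenLagrange.g γ σ x y j p * GenLagrange.sh γ σ i x y) * y p) ∧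
    (∀ i j, GenLagrange.f γ σ i j x y =
      ∑ p, (GenLagrange.g γ σ x y i p * GenLagrange.sv σ j x y
        - GenLagrange.g γ σ x y j p * GenLagrange.sv σ i x y) * y p) ∧
    -- the Maxwell equations
    (∀ i j k,
      GenLagrange.cyc (fun i j k => GenLagrange.hCov2 γ σ (GenLagrange.F γ σ) i j k x y) i j k =
        - GenLagrange.cyc (fun i j k => ∑ p, ∑ q, ∑ h, GenLagrange.g γ σ x y i p *
            GenLagrange.rCurv γ h q j k x * GenLagrange.sv σ h x y * y p * y q) i j k) ∧
    (∀ i j k,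
      GenLagrange.cyc (fun i j k => GenLagrange.vCov2 γ σ (GenLagrange.F γ σ) i j k x y) i j k =
        - GenLagrange.cyc (fun i j k =>
            GenLagrange.hCov2 γ σ (GenLagrange.f γ σ) i j k x y) i j k) ∧
    (∀ i j k,
      GenLagrange.cyc (fun i j k =>
        GenLagrange.vCov2 γ σ (GenLagrange.f γ σ) i j k x y) i j k = 0) ∧
    -- the Einstein equations
    (∀ (κ : ℝ) (TH TV : Fin n → Fin n → GenLagrange.Fn n),
      GenLagrange.EinsteinEquations γ σ κ TH TV x y ↔
        (∀ i j, GenLagrange.rRic γ i j x - (1 / 2) * GenLagrange.rScal γ x * γ x i j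
          + GenLagrange.corr γ σ i j x y = κ * TH i j x y) ∧
        (∀ a b, (2 - (n : ℝ)) * (GenLagrange.sv2 γ σ a b x y
          - GenLagrange.sigmaDot γ σ x y * γ x a b) = κ * TV a b x y)) := by
  subst hγ hσe
  set V := e.target ×ˢ (Set.univ : Set (GenLagrange.Coord n)) ∩
    (fun p : GenLagrange.Coord n × GenLagrange.Coord n =>
      GenLagrange.tangentPoint e p.1 p.2) ⁻¹' U with hV
  have hVo : IsOpen V := GenLagrange.isOpen_chartDomain hU he
  have hp : (x, y) ∈ V := ⟨⟨hx, trivial⟩, hxy⟩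
  have hs : GenLagrange.IsSmooth V (GenLagrange.localFn σM e) :=
    GenLagrange.contDiffOn_localFn hσ he
  have h₀ : GenLagrange.IsMetric V GenLagrange.dx fun x _ => GenLagrange.localMetric γM e x :=
    { isOpen := hVo
      der := GenLagrange.isDerivation_dx hVo
      smooth := fun i j => (GenLagrange.contDiffOn_localMetric γM he i j).comp
        contDiff_fst.contDiffOn fun p hp => hp.1.1
      symm := fun x _ => GenLagrange.localMetric_symm γM e x
      det := fun x y hp => GenLagrange.det_localMetric_ne_zero γM he hp.1.1 }
  refine ⟨fun i j => ?_, fun i j => ?_, h₀.maxwell_hh hs hp, h₀.maxwell_hv hs hp,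
    h₀.maxwell_vv hs hp, fun κ TH TV => ?_⟩
  · rw [h₀.F_eq hs hp, GenLagrange.sum_eq_lowerLiouville]
  · rw [h₀.f_eq hs hp, GenLagrange.sum_eq_lowerLiouville]
  · simp only [GenLagrange.EinsteinEquations, h₀.einstein_h hs hp, h₀.einstein_v hs hp]
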